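/- Let $g\ge 0$ be a measurable function on $\mathbb R$ such that $\nu(dv)=g(v)\,dv$ is a probability measure and $$\int_{\mathbb R} g(v)\,v^2\,dv=1,\qquad \int_{\mathbb R} g(v)\,v^4\,dv<+\infty,\qquad g\in L^p(\mathbb R)\ \text{ for some } p>1 .$$ For $N\ge 1$ let $\sigma^N$ be the uniform probability measure on the sphere $S^{N-1}(\sqrt N)\subset\mathbb R^N$ of radius $\sqrt N$, and let $$\nu^{(N)}=[\nu^{\otimes N}]_{S^{N-1}(\sqrt N)}:=\frac{\prod_{j=1}^N g(v_j)}{Z_N(g,\sqrt N)}\,\sigma^N,\qquad Z_N(g,\sqrt N)=\int_{S^{N-1}(\sqrt N)}\prod_{j=1}^N g(v_j)\,d\sigma^N(v),$$ be the conditioned tensor product of $\nu$ (it is well defined for all sufficiently large $N$). For each $N\ge1$ let $\mu^{(N)}$ be a Borel probability measure on $S^{N-1}(\sqrt N)$ that is symmetric, i.e. invariant under permutations of the coordinates $v_1,\dots,v_N$. Write $H(\mu|\nu)=\int h\log h\,d\nu$ with $h=d\mu/d\nu$ if $\mu\ll\nu$, and $H(\mu|\nu)=+\infty$ otherwise. Suppose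 that $$\frac{H(\mu^{(N)}\,|\,\nu^{(N)})}{N}\longrightarrow 0\qquad (N\to\infty).$$ Then $(\mu^{(N)})$ is $\nu$-chaotic: each $\mu^{(N)}$ is symmetric and, for every integer $k\ge 1$, the marginal $P_k\mu^{(N)}$ (the law of $(v_1,\dots,v_k)$ under $\mu^{(N)}$, defined for $N\ge k$) converges weakly, i.e. against bounded continuous test functions on $\mathbb R^k$, to $\nu^{\otimes k}$ as $N\to\infty$. -/

import Mathlib

open MeasureTheory Filter Topology

namespace KacChaos

noncomputable section

/-- The sphere `S^{N-1}(√N)` of radius `√N` in `ℝ^N`. -/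
abbrev KacSphere (N : ℕ) : Type :=
  Metric.sphere (0 : EuclideanSpace ℝ (Fin N)) (Real.sqrt N)

/-- The dilation by `√N` from the unit sphere onto `S^{N-1}(√N)`. -/
def dilate (N : ℕ) (x : Metric.sphere (0 : EuclideanSpace ℝ (Fin N)) 1) : KacSphere N :=
  ⟨Real.sqrt N • (x : EuclideanSpace ℝ (Fin N)), by
    have hx : ‖(x : EuclideanSpace ℝ (Fin N))‖ = 1 := by simp
    rw [mem_sphere_zero_iff_norm, norm_smul, hx, mul_one, Real.norm_of_nonneg (Real.sqrt_nonneg _)]⟩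

/-- The uniform probability measure `σ^N` on `S^{N-1}(√N)` (for `N ≥ 1`): the surface measure
of the unit sphere, normalised to total mass one and transported by the dilation. -/
def uniformSphere (N : ℕ) : Measure (KacSphere N) :=
  ((volume : Measure (EuclideanSpace ℝ (Fin N))).toSphere Set.univ)⁻¹ •
    ((volume : Measure (EuclideanSpace ℝ (Fin N))).toSphere.map (dilate N))

/-- The normalisation `Z_N(f, √N) = ∫ ∏_j f(v_j) dσ^N(v)`, as an extended nonnegative number. -/
def partitionFn (f : ℝ → ℝ) (N : ℕ) : ENNReal :=
  ∫⁻ v : KacSphere N, ∏ j, ENNReal.ofReal (f (v.1 j)) ∂(uniformSphere N)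

/-- The conditioned tensor product `[(f dv)^{⊗N}]` on `S^{N-1}(√N)`: the measure with density
`∏_j f(v_j) / Z_N(f, √N)` with respect to `σ^N`. -/
def condTensor (f : ℝ → ℝ) (N : ℕ) : Measure (KacSphere N) :=
  (uniformSphere N).withDensity
    (fun v => (∏ j, ENNReal.ofReal (f (v.1 j))) / partitionFn f N)

/-- Permutation of the coordinates of a point of the sphere. -/
def permute {N : ℕ} (τ : Equiv.Perm (Fin N)) (v : KacSphere N) : KacSphere N :=
  ⟨WithLp.toLp 2 (fun i => v.1 (τ i)), by
    refine mem_sphere_zero_iff_norm.2 (Eq.trans ?_ (mem_sphere_zero_iff_norm.1 v.2))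
    rw [EuclideanSpace.norm_eq, EuclideanSpace.norm_eq]
    congr 1
    exact Equiv.sum_comp τ (fun i => ‖v.1 i‖ ^ 2)⟩

/-- A measure on the sphere is symmetric if it is invariant under all permutations of the
coordinates. -/
def IsSymmetric {N : ℕ} (μ : Measure (KacSphere N)) : Prop :=
  ∀ τ : Equiv.Perm (Fin N), μ.map (permute τ) = μ

/-- The first `k` coordinates `(v_1, …, v_k)` of a point of the sphere in `ℝ^N`. In the irrelevant
case `k > N` the missing coordinates are set to `0`. -/
def firstCoords (k N : ℕ) (v : KacSphere N) : Fin k → ℝ :=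
  fun i => if h : (i : ℕ) < N then v.1 ⟨i, h⟩ else 0

theorem measurable_firstCoords (k N : ℕ) : Measurable (firstCoords k N) := by
  refine measurable_pi_lambda _ fun i => ?_
  unfold firstCoords
  split_ifs <;> fun_prop

/-- The marginal `P_k μ` of a probability measure on the sphere: the law of the first `k`
coordinates. -/
def marginal (k : ℕ) {N : ℕ} (μ : ProbabilityMeasure (KacSphere N)) :
    ProbabilityMeasure (Fin k → ℝ) :=
  μ.map (measurable_firstCoords k N).aemeasurable

/-- The `k`-fold tensor product `ν^{⊗k}`, a probability measure on `ℝ^k`. -/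
def tensorPower (ν : ProbabilityMeasure ℝ) (k : ℕ) : ProbabilityMeasure (Fin k → ℝ) :=
  ProbabilityMeasure.pi fun _ => ν

/-- A sequence of probability measures `μ^{(N)}` on `S^{N-1}(√N)` is `ν`-chaotic if each
`μ^{(N)}` is symmetric and, for each positive integer `k`, the marginals `P_k μ^{(N)}` converge
to `ν^{⊗k}` weakly, i.e. against bounded continuous functions (this is the topology of
`ProbabilityMeasure`). -/
structure IsChaotic (ν : ProbabilityMeasure ℝ) (μ : ∀ N : ℕ, ProbabilityMeasure (KacSphere N)) :
    Prop where
  symmetric : ∀ N, 1 ≤ N → IsSymmetric (μ N : Measure (KacSphere N))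
  tendsto_marginal : ∀ k, 1 ≤ k →
    Tendsto (fun N => marginal k (μ N)) atTop (𝓝 (tensorPower ν k))

end

end KacChaos

open MeasureTheory Filter Topology ProbabilityTheory
open scoped ENNReal

/-!
Write `m` for `g(v) dv`. The entropy inequality of Donsker and Varadhan, applied to the average of a
bounded `φ` over the `⌊N / k⌋` disjoint blocks of `k` coordinates, gives the result as soon as the
law of the first `N` of `N + d + 2` coordinates under the conditioned tensor product is at most
`e^{εN} m^{⊗N}`, for some fixed `d`, every `ε > 0` and all large `N`. Under `m^{⊗N}` the blocks are
independent, so Hoeffding's bound controls the exponential moments of the average; under the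
symmetric measure all blocks have the law of the first one.

For the domination, fix `d` with `1 + 2 / d ≤ p`, so that `g ∈ L^{1 + 2/d}`. Two of the `d + 2`
superfluous factors `g(v_j)` are bounded by the geometric mean of the others, and the law of the
remaining `N + d` coordinates under the uniform measure of the sphere is at most a multiple of
Lebesgue measure. This bounds the numerator. Up to the same normalisation of the uniform measure,
`Z_N` is the value at `N` of the density of `∑ v_j²` under `m^{⊗N}`. The law of `v²` has mean `1`
and charges both sides of `1`, so its convolution powers are at least `e^{-BN}` on a neighbourhood
of the mean of width proportional to `N`; using this for a small proportion of the coordinates, and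
the law of large numbers for the others, gives `e^{-εN}` for every `ε > 0`.
-/

namespace KacChaos

section GraphCoordinates

/-- The density of the image of `φ(z) dz` under `z ↦ z²` is half of `foldSq φ`. It vanishes at
`t ≤ 0` because `(√t)⁻¹ = 0` there. -/
noncomputable def foldSq (φ : ℝ → ℝ≥0∞) (t : ℝ) : ℝ≥0∞ :=
  ENNReal.ofReal (√t)⁻¹ * (φ √t + φ (-√t))

theorem foldSq_of_nonpos (φ : ℝ → ℝ≥0∞) {t : ℝ} (ht : t ≤ 0) : foldSq φ t = 0 := by
  simp [foldSq, Real.sqrt_eq_zero_of_nonpos ht]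

theorem measurable_foldSq {φ : ℝ → ℝ≥0∞} (hφ : Measurable φ) : Measurable (foldSq φ) := by
  unfold foldSq
  fun_prop

theorem setLIntegral_Ioi_zero_eq_comp_sqrt (φ : ℝ → ℝ≥0∞) :
    ∫⁻ z in Set.Ioi 0, φ z = ∫⁻ t in Set.Ioi 0, ENNReal.ofReal (1 / (2 * √t)) * φ √t := by
  have himage : Real.sqrt '' Set.Ioi 0 = Set.Ioi 0 := by
    refine (Set.image_subset_iff.2 fun t ht => Real.sqrt_pos.2 ht).antisymm fun z hz => ?_
    exact ⟨z ^ 2, Set.mem_Ioi.2 (pow_pos hz 2), Real.sqrt_sq (le_of_lt hz)⟩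
  have hinj : Set.InjOn Real.sqrt (Set.Ioi 0) := fun s hs t ht hst =>
    (Real.sqrt_inj (le_of_lt hs) (le_of_lt ht)).1 hst
  have hderiv : ∀ t ∈ Set.Ioi (0 : ℝ), HasDerivWithinAt Real.sqrt (1 / (2 * √t)) (Set.Ioi 0) t :=
    fun t ht => (Real.hasDerivAt_sqrt (ne_of_gt ht)).hasDerivWithinAt
  conv_lhs => rw [← himage]
  rw [lintegral_image_eq_lintegral_abs_deriv_mul measurableSet_Ioi hderiv hinj]
  exact lintegral_congr fun t => by rw [abs_of_nonneg (by positivity)]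

theorem lintegral_eq_setLIntegral_Ioi_add_neg (φ : ℝ → ℝ≥0∞) :
    ∫⁻ z, φ z = (∫⁻ z in Set.Ioi 0, φ z) + ∫⁻ z in Set.Ioi 0, φ (-z) := by
  have hneg : ∫⁻ z in Set.Ioi 0, φ (-z) = ∫⁻ z in Set.Iio 0, φ z := by
    simpa using (Measure.measurePreserving_neg (volume : Measure ℝ)).setLIntegral_comp_preimage_emb
      (MeasurableEquiv.neg ℝ).measurableEmbedding φ (Set.Iio 0)
  rw [hneg, ← setLIntegral_congr (Iio_ae_eq_Iic (a := (0 : ℝ))).symm, add_comm,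
    ← lintegral_add_compl φ (measurableSet_Iic (a := (0 : ℝ))), Set.compl_Iic]

theorem lintegral_eq_lintegral_foldSq {φ : ℝ → ℝ≥0∞} (hφ : Measurable φ) :
    ∫⁻ z, φ z = 2⁻¹ * ∫⁻ t, foldSq φ t := by
  have hweight : ∀ t : ℝ, ENNReal.ofReal (1 / (2 * √t)) = 2⁻¹ * ENNReal.ofReal (√t)⁻¹ := fun t => by
    rw [one_div, mul_inv, ENNReal.ofReal_mul (by positivity), ENNReal.ofReal_inv_of_pos two_pos,
      ENNReal.ofReal_ofNat]
  have hsupport : Function.support (foldSq φ) ⊆ Set.Ioi 0 := fun t ht =>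
    not_le.1 fun h => ht (foldSq_of_nonpos φ h)
  calc ∫⁻ z, φ z
      = ∫⁻ t in Set.Ioi 0, 2⁻¹ * foldSq φ t := by
        rw [lintegral_eq_setLIntegral_Ioi_add_neg, setLIntegral_Ioi_zero_eq_comp_sqrt φ,
          setLIntegral_Ioi_zero_eq_comp_sqrt fun z => φ (-z), ← lintegral_add_left (by fun_prop)]
        exact lintegral_congr fun t => by rw [foldSq, hweight]; ring
    _ = 2⁻¹ * ∫⁻ t, foldSq φ t := by
        rw [lintegral_const_mul _ (measurable_foldSq hφ), ← lintegral_indicator measurableSet_Ioi,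
          Set.indicator_eq_self.2 hsupport]

theorem measurable_insertNth {α β : Type*} [MeasurableSpace α] [MeasurableSpace β] {n : ℕ}
    (p : Fin (n + 1)) {f : α → β} {g : α → Fin n → β} (hf : Measurable f) (hg : Measurable g) :
    Measurable fun a => p.insertNth (α := fun _ => β) (f a) (g a) :=
  (MeasurableEquiv.piFinSuccAbove (fun _ => β) p).symm.measurable.comp (hf.prodMk hg)

theorem lintegral_insertNth {α : Type*} [MeasurableSpace α] {n : ℕ} (p : Fin (n + 1))
    (m : Measure α) [SigmaFinite m] {F : (Fin (n + 1) → α) → ℝ≥0∞} (hF : Measurable F) :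
    ∫⁻ x, F x ∂(Measure.pi fun _ => m) =
      ∫⁻ w, ∫⁻ z, F (p.insertNth (α := fun _ => α) z w) ∂m ∂(Measure.pi fun _ => m) := by
  rw [← (measurePreserving_piFinSuccAbove (fun _ => m) p).symm.lintegral_comp hF]
  exact lintegral_prod_symm' _ (hF.comp (MeasurableEquiv.measurable _))

theorem sum_sq_insertNth {n : ℕ} (p : Fin (n + 1)) (z : ℝ) (w : Fin n → ℝ) :
    ∑ i, (p.insertNth (α := fun _ => ℝ) z w) i ^ 2 = z ^ 2 + ∑ i, w i ^ 2 := by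
  simp [Fin.sum_univ_succAbove _ p]

theorem smul_insertNth {n : ℕ} (p : Fin (n + 1)) (a z : ℝ) (w : Fin n → ℝ) :
    a • (p.insertNth (α := fun _ => ℝ) z w) = p.insertNth (α := fun _ => ℝ) (a * z) (a • w) := by
  ext i
  refine Fin.succAboveCases p ?_ (fun j => ?_) i <;> simp

theorem lintegral_comp_smul_pi (n : ℕ) {a : ℝ} (ha : 0 < a) {f : (Fin n → ℝ) → ℝ≥0∞}
    (hf : Measurable f) :
    ∫⁻ w, f (a • w) = ENNReal.ofReal (a ^ n)⁻¹ * ∫⁻ w, f w := by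
  have hmap := Measure.map_addHaar_smul (volume : Measure (Fin n → ℝ)) ha.ne'
  rw [← lintegral_map hf (by fun_prop), hmap, lintegral_smul_measure, Module.finrank_fin_fun,
    abs_of_pos (by positivity), smul_eq_mul]

/-- The sum of `F` over the two points above `w` of the sphere `∑ vᵢ² = R`, viewed as a double
graph over the hyperplane `v_p = 0`, with the weight `(R - |w|²)^{-1/2}` to which the surface
measure is proportional. -/
noncomputable def sheetSum {n : ℕ} (p : Fin (n + 1)) (F : (Fin (n + 1) → ℝ) → ℝ≥0∞) (R : ℝ)
    (w : Fin n → ℝ) : ℝ≥0∞ :=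
  foldSq (fun z => F (p.insertNth (α := fun _ => ℝ) z w)) (R - ∑ i, w i ^ 2)

variable {n : ℕ} (p : Fin (n + 1)) {F : (Fin (n + 1) → ℝ) → ℝ≥0∞}

theorem measurable_sheetSum_uncurry (hF : Measurable F) :
    Measurable fun x : ℝ × (Fin n → ℝ) => sheetSum p F x.1 x.2 := by
  have hsqrt : Measurable fun x : ℝ × (Fin n → ℝ) => √(x.1 - ∑ i, x.2 i ^ 2) := by fun_prop
  exact hsqrt.inv.ennreal_ofReal.mul
    ((hF.comp (measurable_insertNth p hsqrt measurable_snd)).add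
      (hF.comp (measurable_insertNth p hsqrt.neg measurable_snd)))

theorem measurable_sheetSum (hF : Measurable F) (R : ℝ) : Measurable (sheetSum p F R) :=
  (measurable_sheetSum_uncurry p hF).comp measurable_prodMk_left

theorem sheetSum_of_nonpos (F : (Fin (n + 1) → ℝ) → ℝ≥0∞) {R : ℝ} (hR : R ≤ 0) (w : Fin n → ℝ) :
    sheetSum p F R w = 0 :=
  foldSq_of_nonpos _ (sub_nonpos.2 (hR.trans (Fintype.sum_nonneg fun i => sq_nonneg (w i))))

theorem sheetSum_congr {F H : (Fin (n + 1) → ℝ) → ℝ≥0∞} {R : ℝ}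
    (h : ∀ x, ∑ i, x i ^ 2 = R → F x = H x) (w : Fin n → ℝ) :
    sheetSum p F R w = sheetSum p H R w := by
  obtain hw | hw := le_or_gt (R - ∑ i, w i ^ 2) 0
  · rw [sheetSum, sheetSum, foldSq_of_nonpos _ hw, foldSq_of_nonpos _ hw]
  · have hsphere : ∀ z, z ^ 2 = R - ∑ i, w i ^ 2 →
        F (p.insertNth (α := fun _ => ℝ) z w) = H (p.insertNth (α := fun _ => ℝ) z w) :=
      fun z hz => h _ (by rw [sum_sq_insertNth, hz]; ring)
    simp only [sheetSum, foldSq]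
    rw [hsphere _ (Real.sq_sqrt hw.le), hsphere _ (by rw [neg_sq, Real.sq_sqrt hw.le])]

theorem sheetSum_comp_smul (F : (Fin (n + 1) → ℝ) → ℝ≥0∞) {a : ℝ} (ha : 0 < a) (R : ℝ)
    (w : Fin n → ℝ) :
    sheetSum p (fun x => F (a • x)) R w = ENNReal.ofReal a * sheetSum p F (a ^ 2 * R) (a • w) := by
  have hsqrt : √(a ^ 2 * R - ∑ i, (a • w) i ^ 2) = a * √(R - ∑ i, w i ^ 2) := by
    simp only [Pi.smul_apply, smul_eq_mul, mul_pow]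
    rw [← Finset.mul_sum, ← mul_sub, Real.sqrt_mul (sq_nonneg a), Real.sqrt_sq ha.le]
  simp only [sheetSum, foldSq, hsqrt, smul_insertNth]
  rw [← mul_assoc, ← ENNReal.ofReal_mul ha.le, mul_inv, mul_inv_cancel_left₀ ha.ne', mul_neg]

theorem lintegral_sheetSum_comp_smul (hF : Measurable F) {a : ℝ} (ha : 0 < a) (R : ℝ) :
    ∫⁻ w, sheetSum p (fun x => F (a • x)) R w =
      ENNReal.ofReal (a * (a ^ n)⁻¹) * ∫⁻ w, sheetSum p F (a ^ 2 * R) w := by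
  have hmeas := measurable_sheetSum p hF (a ^ 2 * R)
  simp_rw [sheetSum_comp_smul p F ha]
  rw [lintegral_const_mul _ (by fun_prop),
    lintegral_comp_smul_pi n ha hmeas, ← mul_assoc, ← ENNReal.ofReal_mul ha.le]

theorem lintegral_eq_lintegral_sheetSum (hF : Measurable F) :
    ∫⁻ x, F x = 2⁻¹ * ∫⁻ R, ∫⁻ w, sheetSum p F R w := by
  have hmeas : Measurable (Function.uncurry fun (w : Fin n → ℝ) R => sheetSum p F R w) :=
    (measurable_sheetSum_uncurry p hF).comp measurable_swap
  have hfiber : ∀ w : Fin n → ℝ,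
      ∫⁻ z, F (p.insertNth (α := fun _ => ℝ) z w) = 2⁻¹ * ∫⁻ R, sheetSum p F R w := fun w => by
    have hline : Measurable fun z => F (p.insertNth (α := fun _ => ℝ) z w) :=
      hF.comp (measurable_insertNth p measurable_id measurable_const)
    rw [lintegral_eq_lintegral_foldSq hline, ← lintegral_sub_right_eq_self _ (∑ i, w i ^ 2)]
    rfl
  rw [volume_pi, lintegral_insertNth p volume hF, ← volume_pi, lintegral_congr hfiber,
    lintegral_const_mul _ hmeas.lintegral_prod_right, lintegral_lintegral_swap hmeas.aemeasurable]

end GraphCoordinates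

section UniformMeasure

theorem lintegral_normalize_mul_norm {E : Type*} [NormedAddCommGroup E] [NormedSpace ℝ E]
    [FiniteDimensional ℝ E] [Nontrivial E] [MeasurableSpace E] [BorelSpace E] (μ : Measure E)
    [μ.IsAddHaarMeasure] {H : E → ℝ≥0∞} (hH : Measurable H) {φ : ℝ → ℝ≥0∞} (hφ : Measurable φ) :
    ∫⁻ x, H (‖x‖⁻¹ • x) * φ ‖x‖ ∂μ =
      (∫⁻ ω, H ω ∂μ.toSphere) *
        ∫⁻ r : Set.Ioi (0 : ℝ), φ r ∂Measure.volumeIoiPow (Module.finrank ℝ E - 1) := by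
  have hHsphere : Measurable fun ω : Metric.sphere (0 : E) 1 => H ω :=
    hH.comp measurable_subtype_coe
  have hφpos : Measurable fun r : Set.Ioi (0 : ℝ) => φ r := hφ.comp measurable_subtype_coe
  have hprod : Measurable fun y : Metric.sphere (0 : E) 1 × Set.Ioi (0 : ℝ) => H y.1 * φ y.2 :=
    (hHsphere.comp measurable_fst).mul (hφpos.comp measurable_snd)
  rw [← lintegral_prod_mul hHsphere.aemeasurable hφpos.aemeasurable,
    ← μ.measurePreserving_homeomorphUnitSphereProd.lintegral_comp hprod]
  nth_rw 1 [← restrict_compl_singleton (μ := μ) 0]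
  rw [← lintegral_subtype_comap (measurableSet_singleton 0).compl
    (fun x : E => H (‖x‖⁻¹ • x) * φ ‖x‖)]
  simp

theorem measurable_dilate (N : ℕ) : Measurable (dilate N) := by
  unfold dilate
  exact Measurable.subtype_mk (by fun_prop)

instance isProbabilityMeasure_uniformSphere (n : ℕ) :
    IsProbabilityMeasure (uniformSphere (n + 1)) where
  measure_univ := by
    rw [uniformSphere, Measure.smul_apply, Measure.map_apply (measurable_dilate _) .univ,
      Set.preimage_univ, smul_eq_mul]
    exact ENNReal.inv_mul_cancel (Measure.measure_univ_ne_zero.2 (Measure.toSphere_ne_zero _))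
      (measure_ne_top _ _)

theorem exists_lintegral_uniformSphere_eq_mul_lintegral_ball (n : ℕ) :
    ∃ c : ℝ≥0∞, ∀ F : (Fin (n + 1) → ℝ) → ℝ≥0∞, Measurable F →
      ∫⁻ v : KacSphere (n + 1), F v.1 ∂uniformSphere (n + 1) =
        c * ∫⁻ x : Fin (n + 1) → ℝ, F ((√(n + 1 : ℕ) * (√(∑ i, x i ^ 2))⁻¹) • x) *
          (Set.Iio (1 : ℝ)).indicator 1 √(∑ i, x i ^ 2) := by
  set radial : ℝ≥0∞ := ENNReal.ofReal (1 / ((n : ℝ) + 1))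
  have hradial_ne_zero : radial ≠ 0 := (ENNReal.ofReal_pos.2 (by positivity)).ne'
  refine ⟨((volume : Measure (EuclideanSpace ℝ (Fin (n + 1)))).toSphere Set.univ)⁻¹ * radial⁻¹,
    fun F hF => ?_⟩
  have hball : Measurable ((Set.Iio (1 : ℝ)).indicator (1 : ℝ → ℝ≥0∞)) :=
    measurable_one.indicator measurableSet_Iio
  have hball_pos : ∫⁻ r : Set.Ioi (0 : ℝ), (Set.Iio (1 : ℝ)).indicator 1 (r : ℝ)
      ∂Measure.volumeIoiPow n = radial := by
    have h := Measure.volumeIoiPow_apply_Iio n ⟨1, Set.mem_Ioi.2 one_pos⟩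
    rw [one_pow, ← lintegral_indicator_one measurableSet_Iio] at h
    exact h
  have hpolar := lintegral_normalize_mul_norm
    (volume : Measure (EuclideanSpace ℝ (Fin (n + 1))))
    (H := fun x => F (√(n + 1 : ℕ) • x).ofLp) (by fun_prop) hball
  rw [finrank_euclideanSpace_fin, Nat.add_sub_cancel, hball_pos,
    ← (PiLp.volume_preserving_toLp (Fin (n + 1))).lintegral_comp (by fun_prop)] at hpolar
  have hcoords : ∀ x : Fin (n + 1) → ℝ, ‖WithLp.toLp 2 x‖ = √(∑ i, x i ^ 2) := fun x => by
    simp [EuclideanSpace.norm_eq]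
  simp only [hcoords, WithLp.ofLp_smul, smul_smul] at hpolar
  rw [uniformSphere, lintegral_smul_measure, lintegral_map (by fun_prop) (measurable_dilate _),
    hpolar, smul_eq_mul, mul_comm (lintegral _ _), mul_assoc, ← mul_assoc radial⁻¹,
    ENNReal.inv_mul_cancel hradial_ne_zero ENNReal.ofReal_ne_top, one_mul]
  rfl

theorem lintegral_normalize_mul_eq_mul_lintegral_sheetSum {n : ℕ} (p : Fin (n + 1))
    {F : (Fin (n + 1) → ℝ) → ℝ≥0∞} (hF : Measurable F) {R : ℝ} (hR : 0 < R) {φ : ℝ → ℝ≥0∞}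
    (hφ : Measurable φ) :
    ∫⁻ x, F ((√R * (√(∑ i, x i ^ 2))⁻¹) • x) * φ √(∑ i, x i ^ 2) =
      (2⁻¹ * ∫⁻ t in Set.Ioi 0,
        φ √t * ENNReal.ofReal (√R * (√t)⁻¹ * ((√R * (√t)⁻¹) ^ n)⁻¹)) *
          ∫⁻ w, sheetSum p F R w := by
  set f : (Fin (n + 1) → ℝ) → ℝ≥0∞ := fun x =>
    F ((√R * (√(∑ i, x i ^ 2))⁻¹) • x) * φ √(∑ i, x i ^ 2) with hf
  have hshell : ∀ t ∈ Set.Ioi (0 : ℝ), ∫⁻ w, sheetSum p f t w =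
      φ √t * ENNReal.ofReal (√R * (√t)⁻¹ * ((√R * (√t)⁻¹) ^ n)⁻¹) * ∫⁻ w, sheetSum p F R w := by
    intro t ht
    have hscale : 0 < √R * (√t)⁻¹ := mul_pos (Real.sqrt_pos.2 hR) (inv_pos.2 (Real.sqrt_pos.2 ht))
    have hradius : (√R * (√t)⁻¹) ^ 2 * t = R := by
      rw [mul_pow, inv_pow, Real.sq_sqrt hR.le, Real.sq_sqrt (le_of_lt ht),
        inv_mul_cancel_right₀ (ne_of_gt ht)]
    have hfactor : ∀ w, sheetSum p f t w =
        φ √t * sheetSum p (fun x => F ((√R * (√t)⁻¹) • x)) t w := fun w => by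
      rw [sheetSum_congr p (H := fun x => F ((√R * (√t)⁻¹) • x) * φ √t) fun x hx => by
        rw [hf, ← hx]]
      simp only [sheetSum, foldSq]
      ring
    rw [lintegral_congr hfactor, lintegral_const_mul _ (measurable_sheetSum p (by fun_prop) t),
      lintegral_sheetSum_comp_smul p hF hscale, hradius, ← mul_assoc]
  have hsupport : (Function.support fun t => ∫⁻ w, sheetSum p f t w) ⊆ Set.Ioi 0 := fun t ht =>
    Set.mem_Ioi.2 (not_le.1 fun h => ht (by simp [sheetSum_of_nonpos p f h]))
  rw [lintegral_eq_lintegral_sheetSum p (by fun_prop), ← Set.indicator_eq_self.2 hsupport,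
    lintegral_indicator measurableSet_Ioi, setLIntegral_congr_fun measurableSet_Ioi hshell,
    lintegral_mul_const _ (by fun_prop), mul_assoc]

/-- The factor that makes `sheetSum` compute integrals over the uniform probability measure of the
sphere of dimension `n`, see `lintegral_uniformSphere`. -/
noncomputable def sphereConst (n : ℕ) : ℝ≥0∞ :=
  (∫⁻ w : Fin n → ℝ, sheetSum 0 1 (n + 1 : ℕ) w)⁻¹

theorem exists_lintegral_uniformSphere_eq_mul_lintegral_sheetSum (n : ℕ) :
    ∃ c : ℝ≥0∞, ∀ (p : Fin (n + 1)) (F : (Fin (n + 1) → ℝ) → ℝ≥0∞), Measurable F →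
      ∫⁻ v : KacSphere (n + 1), F v.1 ∂uniformSphere (n + 1) =
        c * ∫⁻ w, sheetSum p F (n + 1 : ℕ) w := by
  obtain ⟨c, hc⟩ := exists_lintegral_uniformSphere_eq_mul_lintegral_ball n
  have hsheet := fun (p : Fin (n + 1)) F (hF : Measurable F) =>
    lintegral_normalize_mul_eq_mul_lintegral_sheetSum p hF (R := (n + 1 : ℕ)) (by positivity)
      (measurable_one.indicator (measurableSet_Iio (a := (1 : ℝ))))
  exact ⟨_, fun p F hF => by rw [hc F hF, hsheet p F hF, ← mul_assoc]⟩

theorem lintegral_uniformSphere {n : ℕ} (p : Fin (n + 1)) {F : (Fin (n + 1) → ℝ) → ℝ≥0∞}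
    (hF : Measurable F) :
    ∫⁻ v : KacSphere (n + 1), F v.1 ∂uniformSphere (n + 1) =
      sphereConst n * ∫⁻ w, sheetSum p F (n + 1 : ℕ) w := by
  obtain ⟨c, hc⟩ := exists_lintegral_uniformSphere_eq_mul_lintegral_sheetSum n
  have h := hc 0 1 measurable_one
  simp only [Pi.one_apply, lintegral_one, measure_univ] at h
  rw [hc p F hF, sphereConst, ENNReal.eq_inv_of_mul_eq_one_left h.symm]

theorem sphereConst_mul_lintegral_sheetSum_one (n : ℕ) :
    sphereConst n * ∫⁻ w : Fin n → ℝ, sheetSum 0 1 (n + 1 : ℕ) w = 1 := by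
  simpa using (lintegral_uniformSphere (n := n) 0 measurable_one).symm

theorem sphereConst_ne_zero (n : ℕ) : sphereConst n ≠ 0 :=
  left_ne_zero_of_mul_eq_one (sphereConst_mul_lintegral_sheetSum_one n)

theorem sphereConst_ne_top (n : ℕ) : sphereConst n ≠ ∞ := fun h =>
  ENNReal.inv_ne_top.2 (right_ne_zero_of_mul_eq_one (sphereConst_mul_lintegral_sheetSum_one n)) h

end UniformMeasure

section UpperBound

theorem lintegral_pi_prod {α : Type*} [MeasurableSpace α] (m : Measure α) [SigmaFinite m] {n : ℕ}
    {f : Fin n → α → ℝ≥0∞} (hf : ∀ i, Measurable (f i)) :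
    ∫⁻ x, ∏ i, f i (x i) ∂(Measure.pi fun _ => m) = ∏ i, ∫⁻ t, f i t ∂m := by
  induction n with
  | zero => simp
  | succ n ih =>
    have htail : Measurable fun x : Fin n → α => ∏ i, f i.succ (x i) := by fun_prop
    rw [lintegral_insertNth 0 m (by fun_prop), Fin.prod_univ_succ, ← ih fun i => hf i.succ,
      ← lintegral_const_mul _ htail]
    refine lintegral_congr fun w => ?_
    simp only [Fin.prod_univ_succ, Fin.insertNth_zero', Fin.cons_zero, Fin.cons_succ]
    rw [lintegral_mul_const _ (hf 0)]

theorem lintegral_pi_withDensity {α : Type*} [MeasurableSpace α] (m : Measure α) [SigmaFinite m]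
    {G : α → ℝ≥0∞} (hG : Measurable G) [SigmaFinite (m.withDensity G)] {n : ℕ}
    {F : (Fin n → α) → ℝ≥0∞} (hF : Measurable F) :
    ∫⁻ w, F w ∂(Measure.pi fun _ => m.withDensity G) =
      ∫⁻ w, (∏ i, G (w i)) * F w ∂(Measure.pi fun _ => m) := by
  induction n with
  | zero =>
    rw [Measure.pi_of_empty, Measure.pi_of_empty]
    simp only [Finset.univ_eq_empty, Finset.prod_empty, one_mul]
  | succ n ih =>
    have hF0 : Measurable fun x : (Fin n → α) × α =>
        F ((0 : Fin (n + 1)).insertNth (α := fun _ => α) x.2 x.1) :=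
      hF.comp (measurable_insertNth 0 measurable_snd measurable_fst)
    rw [lintegral_insertNth 0 _ hF, ih hF0.lintegral_prod_right',
      lintegral_insertNth 0 m (F := fun x => (∏ i, G (x i)) * F x) (by fun_prop)]
    refine lintegral_congr fun w => ?_
    have hFw : Measurable fun z => F ((0 : Fin (n + 1)).insertNth (α := fun _ => α) z w) :=
      hF0.comp measurable_prodMk_left
    rw [lintegral_withDensity_eq_lintegral_mul _ hG hFw, ← lintegral_const_mul _ (hG.mul hFw)]
    refine lintegral_congr fun z => ?_
    simp only [Pi.mul_apply, Fin.prod_univ_succ, Fin.insertNth_zero', Fin.cons_zero,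
      Fin.cons_succ]
    ring

theorem lintegral_fin_add_mul {α : Type*} [MeasurableSpace α] (m : Measure α) [SigmaFinite m]
    {a b : ℕ} {F : (Fin a → α) → ℝ≥0∞} {H : (Fin b → α) → ℝ≥0∞} (hF : Measurable F)
    (hH : Measurable H) :
    ∫⁻ x, F (fun i => x (Fin.castAdd b i)) * H (fun i => x (Fin.natAdd a i))
        ∂(Measure.pi fun _ => m) =
      (∫⁻ y, F y ∂(Measure.pi fun _ => m)) * ∫⁻ z, H z ∂(Measure.pi fun _ => m) := by
  have hsum := measurePreserving_sumPiEquivProdPi_symm fun _ : Fin a ⊕ Fin b => m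
  have hcongr := measurePreserving_piCongrLeft (fun _ : Fin (a + b) => m) finSumFinEquiv
  rw [← (hcongr.comp hsum).lintegral_comp (by fun_prop), ← lintegral_prod_mul (by fun_prop)
    (by fun_prop)]
  refine lintegral_congr fun x => ?_
  congr 2 <;> ext i
  · exact MeasurableEquiv.piCongrLeft_apply_apply (β := fun _ => α) finSumFinEquiv
      ((MeasurableEquiv.sumPiEquivProdPi fun _ => α).symm x) (Sum.inl i)
  · exact MeasurableEquiv.piCongrLeft_apply_apply (β := fun _ => α) finSumFinEquiv
      ((MeasurableEquiv.sumPiEquivProdPi fun _ => α).symm x) (Sum.inr i)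

theorem hasDerivAt_arcsin_div_sqrt {a x : ℝ} (hx : x ∈ Set.Ioo (-√a) √a) :
    HasDerivAt (fun x => Real.arcsin (x / √a)) (√(a - x ^ 2))⁻¹ x := by
  have ha : 0 < √a := by linarith [hx.1, hx.2]
  have hlt : x / √a < 1 := (div_lt_one ha).2 hx.2
  have hgt : -1 < x / √a := (lt_div_iff₀ ha).2 (by linarith [hx.1])
  refine ((Real.hasDerivAt_arcsin hgt.ne' hlt.ne).comp x
    ((hasDerivAt_id' x).div_const √a)).congr_deriv ?_
  rw [one_div, one_div, ← mul_inv, inv_inj, ← Real.sqrt_mul' _ (Real.sqrt_pos.1 ha).le, div_pow,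
    Real.sq_sqrt (Real.sqrt_pos.1 ha).le, sub_mul, one_mul,
    div_mul_cancel₀ _ (Real.sqrt_pos.1 ha).ne']

theorem lintegral_inv_sqrt_sub_sq_le (a : ℝ) :
    ∫⁻ x : ℝ, ENNReal.ofReal (√(a - x ^ 2))⁻¹ ≤ ENNReal.ofReal Real.pi := by
  have hsupport : (Function.support fun x : ℝ => ENNReal.ofReal (√(a - x ^ 2))⁻¹) ⊆
      Set.Ioc (-√a) √a := fun x hx => by
    have hpos : 0 < a - x ^ 2 := by
      simpa only [Function.mem_support, ne_eq, ENNReal.ofReal_eq_zero, not_le, inv_pos,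
        Real.sqrt_pos] using hx
    have hlt := Real.sq_lt.1 (sub_pos.1 hpos)
    exact ⟨hlt.1, hlt.2.le⟩
  have hle : -√a ≤ √a := by linarith [Real.sqrt_nonneg a]
  have hcont : ContinuousOn (fun x => Real.arcsin (x / √a)) (Set.Icc (-√a) √a) :=
    (Real.continuous_arcsin.comp (continuous_id.div_const _)).continuousOn
  have hint := intervalIntegral.integrableOn_deriv_of_nonneg hcont
    (fun x hx => hasDerivAt_arcsin_div_sqrt hx) fun x _ => by positivity
  rw [← Set.indicator_eq_self.2 hsupport, lintegral_indicator measurableSet_Ioc,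
    ← ofReal_integral_eq_lintegral_ofReal hint (ae_of_all _ fun x => by positivity),
    ← intervalIntegral.integral_of_le hle,
    intervalIntegral.integral_eq_sub_of_hasDerivAt_of_le hle hcont
      (fun x hx => hasDerivAt_arcsin_div_sqrt hx)
      ((intervalIntegrable_iff_integrableOn_Ioc_of_le hle).2 hint)]
  gcongr
  linarith [Real.arcsin_le_pi_div_two (√a / √a), Real.neg_pi_div_two_le_arcsin (-√a / √a)]

theorem lintegral_uniformSphere_comp_succAbove_le {n : ℕ} (p : Fin (n + 2)) (q : Fin (n + 1))
    {Φ : (Fin n → ℝ) → ℝ≥0∞} (hΦ : Measurable Φ) :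
    ∫⁻ v : KacSphere (n + 2), Φ (fun j => v.1 (p.succAbove (q.succAbove j)))
        ∂uniformSphere (n + 2) ≤
      sphereConst (n + 1) * (ENNReal.ofReal (2 * Real.pi) * ∫⁻ u, Φ u) := by
  have hsheet : ∀ w : Fin (n + 1) → ℝ,
      sheetSum p (fun v => Φ fun j => v (p.succAbove (q.succAbove j))) (n + 2 : ℕ) w =
        2 * (ENNReal.ofReal (√((n + 2 : ℕ) - ∑ i, w i ^ 2))⁻¹ * Φ fun j => w (q.succAbove j)) :=
    fun w => by
      simp only [sheetSum, foldSq, Fin.insertNth_apply_succAbove]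
      ring
  rw [lintegral_uniformSphere p (F := fun v => Φ fun j => v (p.succAbove (q.succAbove j)))
    (by fun_prop)]
  simp_rw [hsheet]
  rw [lintegral_const_mul _ (by fun_prop), ENNReal.ofReal_mul zero_le_two, ENNReal.ofReal_ofNat,
    mul_assoc, volume_pi, lintegral_insertNth q volume (by fun_prop), ← volume_pi,
    ← lintegral_const_mul _ hΦ]
  gcongr with u
  simp only [Fin.insertNth_apply_succAbove, sum_sq_insertNth, sub_add_eq_sub_sub_swap]
  rw [lintegral_mul_const _ (by fun_prop)]
  gcongr
  exact lintegral_inv_sqrt_sub_sq_le _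

end UpperBound

section ProductBound

theorem le_prod_rpow_of_forall_le {d : ℕ} (hd : d ≠ 0) {y : ℝ≥0∞} {x : Fin d → ℝ≥0∞}
    (h : ∀ j, y ≤ x j) : y ≤ (∏ j, x j) ^ (1 / (d : ℝ)) := by
  rw [one_div, ENNReal.le_rpow_inv_iff (by positivity), ENNReal.rpow_natCast]
  simpa using Finset.prod_le_prod' fun j (_ : j ∈ Finset.univ) => h j

theorem prod_le_sum_prod_succAbove_rpow {d : ℕ} (hd : d ≠ 0) (x : Fin (d + 2) → ℝ≥0∞) :
    ∏ j, x j ≤ ∑ i : Fin (d + 2), ∑ i' : Fin (d + 1),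
      ∏ j : Fin d, x (i.succAbove (i'.succAbove j)) ^ (1 + 2 / (d : ℝ)) := by
  -- The two smallest factors are at most the geometric mean of the `d` others, so deleting them
  -- costs a power `2 / d` of what remains.
  obtain ⟨i, hi⟩ := Finite.exists_min x
  obtain ⟨i', hi'⟩ := Finite.exists_min fun j => x (i.succAbove j)
  set P := ∏ j : Fin d, x (i.succAbove (i'.succAbove j)) with hP
  have hmin : x i ≤ P ^ (1 / (d : ℝ)) := le_prod_rpow_of_forall_le hd fun j => hi _
  have hmin' : x (i.succAbove i') ≤ P ^ (1 / (d : ℝ)) :=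
    le_prod_rpow_of_forall_le hd fun j => hi' _
  calc ∏ j, x j = x i * (x (i.succAbove i') * P) := by
        rw [Fin.prod_univ_succAbove x i, Fin.prod_univ_succAbove _ i']
    _ ≤ P ^ (1 / (d : ℝ)) * (P ^ (1 / (d : ℝ)) * P ^ (1 : ℝ)) := by
        rw [ENNReal.rpow_one]
        gcongr
    _ = P ^ (1 + 2 / (d : ℝ)) := by
        rw [← ENNReal.rpow_add_of_nonneg _ _ (by positivity) zero_le_one,
          ← ENNReal.rpow_add_of_nonneg _ _ (by positivity) (by positivity)]
        congr 1
        ring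
    _ = ∏ j : Fin d, x (i.succAbove (i'.succAbove j)) ^ (1 + 2 / (d : ℝ)) := by
        rw [hP, ENNReal.prod_rpow_of_nonneg (by positivity)]
    _ ≤ ∑ i' : Fin (d + 1), ∏ j : Fin d, x (i.succAbove (i'.succAbove j)) ^ (1 + 2 / (d : ℝ)) :=
        Finset.single_le_sum (f := fun i' : Fin (d + 1) => ∏ j : Fin d,
          x (i.succAbove (i'.succAbove j)) ^ (1 + 2 / (d : ℝ))) (fun _ _ => zero_le)
          (Finset.mem_univ i')
    _ ≤ _ := Finset.single_le_sum (f := fun i : Fin (d + 2) => ∑ i' : Fin (d + 1), ∏ j : Fin d,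
          x (i.succAbove (i'.succAbove j)) ^ (1 + 2 / (d : ℝ))) (fun _ _ => zero_le)
          (Finset.mem_univ i)

theorem natAdd_succAbove_castAdd {N n : ℕ} (i : Fin (n + 1)) (j : Fin N) :
    (Fin.natAdd N i).succAbove (Fin.castAdd n j) = Fin.castAdd (n + 1) j :=
  Fin.succAbove_of_castSucc_lt _ _ (by simp [Fin.lt_def]; omega)

theorem natAdd_succAbove_natAdd {N n : ℕ} (i : Fin (n + 1)) (j : Fin n) :
    (Fin.natAdd N i).succAbove (Fin.natAdd N j) = Fin.natAdd N (i.succAbove j) := by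
  ext
  simp only [Fin.succAbove, Fin.lt_def, Fin.val_castSucc, Fin.val_natAdd, add_lt_add_iff_left]
  split_ifs <;> simp [add_assoc]

section

variable {G : ℝ → ℝ≥0∞} {d N : ℕ} {R : (Fin N → ℝ) → ℝ≥0∞}

theorem lintegral_uniformSphere_prod_succAbove_mul_le (hG : Measurable G)
    [SigmaFinite (volume.withDensity G)] (hR : Measurable R) (q : ℝ) (i : Fin (d + 2))
    (i' : Fin (d + 1)) :
    ∫⁻ v : KacSphere (N + (d + 2)),
        ((∏ j : Fin N, G (v.1 (Fin.castAdd (d + 2) j))) *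
          R fun j => v.1 (Fin.castAdd (d + 2) j)) *
        ∏ j : Fin d, G (v.1 (Fin.natAdd N (i.succAbove (i'.succAbove j)))) ^ q
        ∂uniformSphere (N + (d + 2)) ≤
      sphereConst (N + (d + 1)) * (ENNReal.ofReal (2 * Real.pi) *
        ((∫⁻ y, R y ∂(Measure.pi fun _ => volume.withDensity G)) * (∫⁻ t, G t ^ q) ^ d)) := by
  have hsplit := lintegral_fin_add_mul (volume : Measure ℝ) (a := N) (b := d)
    (F := fun y => (∏ j, G (y j)) * R y) (H := fun z => ∏ j, G (z j) ^ q)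
    (by fun_prop) (by fun_prop)
  have hprod := lintegral_pi_prod (volume : Measure ℝ) (n := d) (f := fun _ t => G t ^ q)
    fun _ => hG.pow_const q
  rw [Finset.prod_const, Finset.card_fin] at hprod
  rw [lintegral_pi_withDensity volume hG hR, ← hprod, ← hsplit]
  refine le_of_eq_of_le (lintegral_congr fun v => ?_)
    (lintegral_uniformSphere_comp_succAbove_le (n := N + d) (Fin.natAdd N i) (Fin.natAdd N i')
      (Φ := fun u => ((∏ j : Fin N, G (u (Fin.castAdd d j))) * R fun j => u (Fin.castAdd d j)) *
        ∏ j : Fin d, G (u (Fin.natAdd N j)) ^ q) (by fun_prop))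
  simp only [natAdd_succAbove_castAdd, natAdd_succAbove_natAdd]

theorem lintegral_uniformSphere_prod_mul_le (hG : Measurable G)
    [SigmaFinite (volume.withDensity G)] (hd : d ≠ 0) (hR : Measurable R) :
    ∫⁻ v : KacSphere (N + (d + 2)), (∏ j, G (v.1 j)) * R (fun j => v.1 (Fin.castAdd (d + 2) j))
        ∂uniformSphere (N + (d + 2)) ≤
      sphereConst (N + (d + 1)) * (((d + 2 : ℕ) * ((d + 1 : ℕ) * (ENNReal.ofReal (2 * Real.pi) *
        (∫⁻ t, G t ^ (1 + 2 / (d : ℝ))) ^ d))) *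
          ∫⁻ y, R y ∂(Measure.pi fun _ => volume.withDensity G)) := by
  let T : Fin (d + 2) → Fin (d + 1) → KacSphere (N + (d + 2)) → ℝ≥0∞ := fun i i' v =>
    ((∏ j : Fin N, G (v.1 (Fin.castAdd (d + 2) j))) * R fun j => v.1 (Fin.castAdd (d + 2) j)) *
      ∏ j : Fin d, G (v.1 (Fin.natAdd N (i.succAbove (i'.succAbove j)))) ^ (1 + 2 / (d : ℝ))
  have hT : ∀ i i', Measurable (T i i') := fun i i' => by fun_prop
  calc ∫⁻ v : KacSphere (N + (d + 2)),
        (∏ j, G (v.1 j)) * R (fun j => v.1 (Fin.castAdd (d + 2) j)) ∂uniformSphere (N + (d + 2))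
      ≤ ∫⁻ v, ∑ i, ∑ i', T i i' v ∂uniformSphere (N + (d + 2)) := by
        refine lintegral_mono fun v => ?_
        rw [Fin.prod_univ_add, mul_right_comm]
        simp only [T, ← Finset.mul_sum]
        gcongr
        exact prod_le_sum_prod_succAbove_rpow hd fun j => G (v.1 (Fin.natAdd N j))
    _ = ∑ i, ∑ i', ∫⁻ v, T i i' v ∂uniformSphere (N + (d + 2)) := by
        rw [lintegral_finsetSum _ fun i _ => Finset.measurable_sum _ fun i' _ => hT i i']
        exact Finset.sum_congr rfl fun i _ => lintegral_finsetSum _ fun i' _ => hT i i'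
    _ ≤ _ := Finset.sum_le_sum fun i _ => Finset.sum_le_sum fun i' _ =>
        lintegral_uniformSphere_prod_succAbove_mul_le hG hR (1 + 2 / (d : ℝ)) i i'
    _ = _ := by
        simp only [Finset.sum_const, Finset.card_univ, Fintype.card_fin, nsmul_eq_mul]
        ring

end

theorem setLIntegral_ofReal_rpow_lt_top {α : Type*} [MeasurableSpace α] {m : Measure α}
    {g : α → ℝ} (hg : Integrable g m) {p : ℝ≥0∞} (hgp : MemLp g p m) {q : ℝ} (hq : 0 < q)
    (hqp : ENNReal.ofReal q ≤ p) :
    ∫⁻ t in {t | 1 < ‖g t‖}, ENNReal.ofReal (g t) ^ q ∂m < ∞ := by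
  have : IsFiniteMeasure (m.restrict {t | 1 < ‖g t‖}) :=
    isFiniteMeasure_restrict.2 (hg.measure_norm_gt_lt_top one_pos).ne
  have hmem := ((hgp.restrict {t | 1 < ‖g t‖}).mono_exponent hqp).eLpNorm_lt_top
  rw [eLpNorm_lt_top_iff_lintegral_rpow_enorm_lt_top (by simpa using hq) ENNReal.ofReal_ne_top,
    ENNReal.toReal_ofReal hq.le] at hmem
  refine lt_of_le_of_lt (lintegral_mono fun t => ?_) hmem
  gcongr
  exact Real.ofReal_le_enorm (g t)

theorem lintegral_ofReal_rpow_lt_top {α : Type*} [MeasurableSpace α] {m : Measure α} {g : α → ℝ}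
    (hg_meas : Measurable g) (hg : Integrable g m) {p : ℝ≥0∞} (hgp : MemLp g p m) {q : ℝ}
    (hq : 1 ≤ q) (hqp : ENNReal.ofReal q ≤ p) : ∫⁻ t, ENNReal.ofReal (g t) ^ q ∂m < ∞ := by
  rw [← lintegral_add_compl _ (measurableSet_lt measurable_const hg_meas.norm)]
  refine ENNReal.add_lt_top.2 ⟨setLIntegral_ofReal_rpow_lt_top hg hgp (by positivity) hqp, ?_⟩
  have hle : ∀ t ∈ {t | 1 < ‖g t‖}ᶜ, ENNReal.ofReal (g t) ^ q ≤ ‖g t‖ₑ := fun t ht => by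
    have hg1 : ENNReal.ofReal (g t) ≤ 1 :=
      ENNReal.ofReal_le_one.2 ((Real.le_norm_self _).trans (not_lt.1 ht))
    exact (ENNReal.rpow_le_self_of_le_one hg1 hq).trans (Real.ofReal_le_enorm (g t))
  exact (setLIntegral_mono hg_meas.enorm hle).trans_lt
    ((setLIntegral_le_lintegral _ _).trans_lt hg.2)

theorem exists_ofReal_one_add_two_div_le {p : ℝ≥0∞} (hp : 1 < p) :
    ∃ d : ℕ, d ≠ 0 ∧ ENNReal.ofReal (1 + 2 / (d : ℝ)) ≤ p := by
  have hlim : Tendsto (fun d : ℕ => ENNReal.ofReal (1 + 2 / (d : ℝ))) atTop (𝓝 1) := by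
    simpa using ENNReal.tendsto_ofReal
      ((tendsto_const_nhds (x := (1 : ℝ))).add (tendsto_const_div_atTop_nhds_zero_nat 2))
  obtain ⟨d, hdp, hd⟩ := ((hlim.eventually_lt_const hp).and (eventually_ne_atTop 0)).exists
  exact ⟨d, hd, hdp.le⟩

end ProductBound

section SquareSumDensity

/-- The convolution powers of `f`, indexed from `0`: if `f` is a probability density, `convPow f n`
is the density of a sum of `n + 1` independent variables of density `f`. -/
noncomputable def convPow (f : ℝ → ℝ≥0∞) : ℕ → ℝ → ℝ≥0∞
  | 0 => f
  | n + 1 => f ⋆ₗ convPow f n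

theorem measurable_convPow {f : ℝ → ℝ≥0∞} (hf : Measurable f) : ∀ n, Measurable (convPow f n)
  | 0 => hf
  | n + 1 => measurable_lconvolution volume hf (measurable_convPow hf n)

theorem convPow_lconvolution_convPow {f : ℝ → ℝ≥0∞} (hf : Measurable f) (m n : ℕ) :
    (convPow f m ⋆ₗ convPow f n) = convPow f (m + n + 1) := by
  induction m with
  | zero => rw [zero_add]; rfl
  | succ m ih =>
    rw [convPow, ← lconvolution_assoc hf (measurable_convPow hf m) (measurable_convPow hf n), ih,
      show m + 1 + n + 1 = m + n + 1 + 1 by ring]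
    rfl

/-- The density of `v²` when `v` has density `G`. -/
noncomputable def sqDensity (G : ℝ → ℝ≥0∞) (t : ℝ) : ℝ≥0∞ := 2⁻¹ * foldSq G t

theorem foldSq_mul_comp_sq (φ ψ : ℝ → ℝ≥0∞) (t : ℝ) :
    foldSq (fun z => φ z * ψ (z ^ 2)) t = foldSq φ t * ψ t := by
  obtain ht | ht := le_or_gt t 0
  · rw [foldSq_of_nonpos _ ht, foldSq_of_nonpos _ ht, zero_mul]
  · simp only [foldSq, neg_sq, Real.sq_sqrt ht.le]
    ring

variable {G : ℝ → ℝ≥0∞} (hG : Measurable G)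

include hG

theorem measurable_sqDensity : Measurable (sqDensity G) :=
  (measurable_foldSq hG).const_mul _

theorem lintegral_comp_sq_withDensity {φ : ℝ → ℝ≥0∞} (hφ : Measurable φ) :
    ∫⁻ v, φ (v ^ 2) ∂(volume.withDensity G) = ∫⁻ t, sqDensity G t * φ t := by
  rw [lintegral_withDensity_eq_lintegral_mul _ hG (by fun_prop),
    lintegral_eq_lintegral_foldSq (by fun_prop),
    ← lintegral_const_mul _ (measurable_foldSq (by fun_prop))]
  refine lintegral_congr fun t => ?_
  rw [sqDensity, mul_assoc, ← foldSq_mul_comp_sq]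
  rfl

theorem sqDensity_lconvolution {φ : ℝ → ℝ≥0∞} (hφ : Measurable φ) (s : ℝ) :
    (sqDensity G ⋆ₗ φ) s = ∫⁻ v, φ (s - v ^ 2) ∂(volume.withDensity G) := by
  rw [lconvolution_def, lintegral_comp_sq_withDensity hG (φ := fun t => φ (s - t)) (by fun_prop)]
  simp only [neg_add_eq_sub]

variable [SigmaFinite (volume.withDensity G)]

theorem lintegral_pi_convPow_sub_sum_sq (M n : ℕ) (s : ℝ) :
    ∫⁻ w : Fin M → ℝ, convPow (sqDensity G) n (s - ∑ i, w i ^ 2)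
        ∂(Measure.pi fun _ => volume.withDensity G) =
      convPow (sqDensity G) (M + n) s := by
  have hmeas := fun k => measurable_convPow (measurable_sqDensity hG) k
  induction M generalizing n with
  | zero => simp [lintegral_unique]
  | succ M ih =>
    have hfiber : ∀ w : Fin M → ℝ, ∫⁻ z, convPow (sqDensity G) n (s - (z ^ 2 + ∑ i, w i ^ 2))
        ∂(volume.withDensity G) = convPow (sqDensity G) (n + 1) (s - ∑ i, w i ^ 2) := fun w => by
      rw [convPow, sqDensity_lconvolution hG (hmeas n)]
      simp only [sub_sub, add_comm]
    have := hmeas n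
    rw [lintegral_insertNth 0 _ (by fun_prop)]
    simp only [sum_sq_insertNth, hfiber]
    rw [ih (n + 1), add_right_comm, add_assoc]

theorem lintegral_uniformSphere_prod (n : ℕ) :
    ∫⁻ v : KacSphere (n + 1), ∏ j, G (v.1 j) ∂uniformSphere (n + 1) =
      sphereConst n * (2 * convPow (sqDensity G) n (n + 1 : ℕ)) := by
  have hmeas := measurable_sqDensity hG
  have hsum : convPow (sqDensity G) n (n + 1 : ℕ) =
      ∫⁻ w : Fin n → ℝ, (∏ i, G (w i)) * sqDensity G ((n + 1 : ℕ) - ∑ i, w i ^ 2) := by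
    rw [volume_pi, ← lintegral_pi_withDensity volume hG (by fun_prop)]
    exact (lintegral_pi_convPow_sub_sum_sq hG n 0 _).symm
  rw [lintegral_uniformSphere 0 (F := fun v => ∏ j, G (v j)) (by fun_prop), hsum,
    ← lintegral_const_mul 2 (by fun_prop)]
  congr 1
  refine lintegral_congr fun w => ?_
  rw [sqDensity, mul_left_comm, ENNReal.mul_inv_cancel_left two_ne_zero ENNReal.ofNat_ne_top]
  simp only [sheetSum, foldSq, Fin.prod_univ_succ, Fin.insertNth_zero', Fin.cons_zero,
    Fin.cons_succ]
  ring

end SquareSumDensity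

section LowerBound

/-- `u` is at least `c` on the interval of radius `r` around `a`. -/
def LowerOn (u : ℝ → ℝ≥0∞) (c : ℝ≥0∞) (a r : ℝ) : Prop :=
  ∀ s, |s - a| ≤ r → c ≤ u s

theorem LowerOn.mono {u : ℝ → ℝ≥0∞} {c c' : ℝ≥0∞} {a a' r r' : ℝ} (h : LowerOn u c a r)
    (hc : c' ≤ c) (hr : |a' - a| + r' ≤ r) : LowerOn u c' a' r' := fun s hs =>
  hc.trans (h s (by linarith [abs_sub_le s a' a]))

theorem LowerOn.lconvolution {u u' : ℝ → ℝ≥0∞} {c c' : ℝ≥0∞} {a a' r r' : ℝ}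
    (h : LowerOn u c a r) (h' : LowerOn u' c' a' r') {l : ℝ} (hl : l ≤ 2 * r) (hl' : l ≤ 2 * r') :
    LowerOn (u ⋆ₗ u') (c * c' * ENNReal.ofReal l) (a + a') (r + r' - l) := fun s hs => by
  obtain ⟨hs₁, hs₂⟩ := abs_le.1 hs
  have hlen : l ≤ min (a + r) (s - a' + r') - max (a - r) (s - a' - r') := by
    rcases max_cases (a - r) (s - a' - r') with hmax | hmax <;>
      rcases min_cases (a + r) (s - a' + r') with hmin | hmin <;> linarith [hmax.1, hmin.1]
  calc c * c' * ENNReal.ofReal l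
      ≤ c * c' * ENNReal.ofReal (min (a + r) (s - a' + r') - max (a - r) (s - a' - r')) := by
        gcongr
    _ = ∫⁻ _ in Set.Icc (max (a - r) (s - a' - r')) (min (a + r) (s - a' + r')), c * c' := by
        rw [setLIntegral_const, Real.volume_Icc]
    _ ≤ ∫⁻ t in Set.Icc (max (a - r) (s - a' - r')) (min (a + r) (s - a' + r')),
          u t * u' (-t + s) := by
        refine setLIntegral_mono' measurableSet_Icc fun t ht => ?_
        obtain ⟨⟨ht₁, ht₂⟩, ht₃, ht₄⟩ := And.intro (max_le_iff.1 ht.1) (le_min_iff.1 ht.2)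
        exact mul_le_mul' (h t (abs_le.2 ⟨by linarith, by linarith⟩))
          (h' _ (abs_le.2 ⟨by linarith, by linarith⟩))
    _ ≤ (u ⋆ₗ u') s := setLIntegral_le_lintegral _ _

theorem LowerOn.convPow_add {f : ℝ → ℝ≥0∞} (hf : Measurable f) {k : ℕ} {c : ℝ≥0∞} {a r : ℝ}
    (h : LowerOn (convPow f k) c a r) (hr : 0 ≤ r) (n : ℕ) :
    LowerOn (convPow f (n * (k + 1) + k)) (c * (c * ENNReal.ofReal (r / 2)) ^ n) ((n + 1) * a)
      (r + n * (r / 2)) := by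
  induction n with
  | zero => simpa using h
  | succ n ih =>
    have hn : 0 ≤ n * (r / 2) := by positivity
    have hconv := ih.lconvolution h (l := r / 2) (by linarith) (by linarith)
    rw [convPow_lconvolution_convPow hf] at hconv
    convert hconv using 1
    · congr 1
      ring
    · ring
    · push_cast
      ring
    · push_cast
      ring

theorem le_volume_inter_sub_preimage {A : Set ℝ} (hA : MeasurableSet A) {a r s x : ℝ}
    (hAr : A ⊆ Metric.closedBall a r) (hvol : ENNReal.ofReal x ≤ volume A)
    (hr : 0 ≤ r) (hx : 0 ≤ x) :
    ENNReal.ofReal (2 * x - (2 * r + |s - 2 * a|)) ≤ volume (A ∩ (fun t => s - t) ⁻¹' A) := by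
  have hreflect : volume ((fun t => s - t) ⁻¹' A) = volume A :=
    (Measure.measurePreserving_sub_left volume s).measure_preimage hA.nullMeasurableSet
  have hunion : A ∪ (fun t => s - t) ⁻¹' A ⊆
      Set.Icc (min a (s - a) - r) (max a (s - a) + r) := by
    refine Set.union_subset (fun t ht => ?_) fun t ht => ?_ <;>
    · have := hAr ht
      rw [Real.closedBall_eq_Icc] at this
      constructor <;> linarith [this.1, this.2, min_le_left a (s - a), min_le_right a (s - a),
        le_max_left a (s - a), le_max_right a (s - a)]
  have hlen : max a (s - a) + r - (min a (s - a) - r) = 2 * r + |s - 2 * a| := by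
    rw [show s - 2 * a = s - a - a by ring, ← max_sub_min_eq_abs]
    ring
  rw [ENNReal.ofReal_sub _ (by positivity), two_mul x, ENNReal.ofReal_add hx hx]
  refine tsub_le_iff_left.2 ?_
  calc ENNReal.ofReal x + ENNReal.ofReal x ≤ volume A + volume ((fun t => s - t) ⁻¹' A) := by
        rw [hreflect]
        gcongr
    _ = volume (A ∪ (fun t => s - t) ⁻¹' A) + volume (A ∩ (fun t => s - t) ⁻¹' A) :=
        (measure_union_add_inter A (hA.preimage (by fun_prop))).symm
    _ ≤ ENNReal.ofReal (2 * r + |s - 2 * a|) + volume (A ∩ (fun t => s - t) ⁻¹' A) := by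
        gcongr
        exact (measure_mono hunion).trans_eq (by rw [Real.volume_Icc, hlen])

theorem exists_mem_le_volume_inter_sub_preimage {E : Set ℝ} (hE : MeasurableSet E)
    (h0 : volume E ≠ 0) :
    ∃ a ∈ E, ∃ r > 0, ∀ s, |s - 2 * a| ≤ r / 2 →
      ENNReal.ofReal (r / 2) ≤ volume (E ∩ (fun t => s - t) ⁻¹' E) := by
  have : (ae (volume.restrict E)).NeBot := ae_neBot.2 (by simpa using h0)
  obtain ⟨a, hlim, ha⟩ :=
    ((Besicovitch.ae_tendsto_measure_inter_div volume E).and (ae_restrict_mem hE)).exists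
  obtain ⟨r, hdensity, hr : 0 < r⟩ := ((hlim.eventually_const_lt (u := ENNReal.ofReal (3 / 4))
    (by norm_num)).and self_mem_nhdsWithin).exists
  have hvol : ENNReal.ofReal (3 / 2 * r) ≤ volume (E ∩ Metric.closedBall a r) := by
    rw [Real.volume_closedBall, ENNReal.lt_div_iff_mul_lt (by simp [hr]) (by simp),
      ← ENNReal.ofReal_mul (by norm_num)] at hdensity
    exact le_trans (le_of_eq (by congr 1; ring)) hdensity.le
  refine ⟨a, ha, r, hr, fun s hs => ?_⟩
  calc ENNReal.ofReal (r / 2) ≤ ENNReal.ofReal (2 * (3 / 2 * r) - (2 * r + |s - 2 * a|)) := by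
        gcongr
        linarith
    _ ≤ volume (E ∩ Metric.closedBall a r ∩ (fun t => s - t) ⁻¹' (E ∩ Metric.closedBall a r)) :=
        le_volume_inter_sub_preimage (hE.inter Metric.isClosed_closedBall.measurableSet)
          Set.inter_subset_right hvol hr.le (by positivity)
    _ ≤ volume (E ∩ (fun t => s - t) ⁻¹' E) :=
        measure_mono (Set.inter_subset_inter Set.inter_subset_left
          (Set.preimage_mono Set.inter_subset_left))

theorem exists_volume_inter_superlevel_ne_zero {f : ℝ → ℝ≥0∞} (hf : Measurable f) {S : Set ℝ}
    (hS : MeasurableSet S) (h0 : ∫⁻ t in S, f t ≠ 0) :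
    ∃ c ≠ 0, volume (S ∩ {t | c ≤ f t}) ≠ 0 := by
  by_contra! hnull
  have hlt (n : ℕ) : ∀ᵐ t ∂volume.restrict S, f t < (n : ℝ≥0∞)⁻¹ := by
    rw [ae_iff, Measure.restrict_apply' hS, Set.inter_comm]
    simpa only [not_lt] using hnull _ (by simp)
  refine h0 ((lintegral_eq_zero_iff hf).2 ?_)
  filter_upwards [ae_all_iff.2 hlt] with t ht
  by_contra hne
  obtain ⟨n, hn⟩ := ENNReal.exists_inv_nat_lt hne
  exact (ht n).not_gt hn

theorem exists_lowerOn_convPow_one {f : ℝ → ℝ≥0∞} (hf : Measurable f) {S : Set ℝ}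
    (hS : MeasurableSet S) (h0 : ∫⁻ t in S, f t ≠ 0) :
    ∃ a ∈ S, ∃ c ≠ 0, ∃ r > 0, LowerOn (convPow f 1) c (2 * a) r := by
  obtain ⟨c, hc, hvol⟩ := exists_volume_inter_superlevel_ne_zero hf hS h0
  have hE : MeasurableSet (S ∩ {t | c ≤ f t}) := hS.inter (measurableSet_le measurable_const hf)
  obtain ⟨a, ha, r, hr, har⟩ := exists_mem_le_volume_inter_sub_preimage hE hvol
  refine ⟨a, ha.1, c * c * ENNReal.ofReal (r / 2), by simp [hc, hr], r / 2, by positivity,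
    fun s hs => ?_⟩
  set E := S ∩ {t | c ≤ f t}
  calc c * c * ENNReal.ofReal (r / 2) ≤ c * c * volume (E ∩ (fun t => s - t) ⁻¹' E) := by
        gcongr
        exact har s hs
    _ = ∫⁻ _ in E ∩ (fun t => s - t) ⁻¹' E, c * c := (setLIntegral_const _ _).symm
    _ ≤ ∫⁻ t in E ∩ (fun t => s - t) ⁻¹' E, f t * f (-t + s) :=
        setLIntegral_mono' (hE.inter (hE.preimage (by fun_prop))) fun t ht => by
          rw [neg_add_eq_sub]
          exact mul_le_mul' ht.1.2 ht.2.2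
    _ ≤ convPow f 1 s := setLIntegral_le_lintegral _ _

end LowerBound

section MeanLowerBound

variable {f : ℝ → ℝ≥0∞} {x : ℝ}

theorem exists_lowerOn_convPow_mean (hf : Measurable f) (hlt : ∫⁻ t in Set.Iio x, f t ≠ 0)
    (hgt : ∫⁻ t in Set.Ioi x, f t ≠ 0) :
    ∃ k c, c ≠ 0 ∧ ∃ r > 0, LowerOn (convPow f k) c ((k + 1) * x) r := by
  obtain ⟨a, ha : a < x, c, hc, r, hr, hLow⟩ := exists_lowerOn_convPow_one hf measurableSet_Iio hlt
  obtain ⟨a', ha' : x < a', c', hc', r', hr', hLow'⟩ :=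
    exists_lowerOn_convPow_one hf measurableSet_Ioi hgt
  have : 0 < x - a := sub_pos.2 ha
  have hβ : 0 < a' - x := sub_pos.2 ha'
  obtain ⟨n, hn⟩ := Archimedean.arch (4 * (a' - x) + r') hr
  rw [nsmul_eq_mul] at hn
  -- `n + 1` copies around `2 * a` and `m + 1` copies around `2 * a'` balance up to a bounded error
  -- while the radii grow linearly.
  set m := ⌊(n + 1) * (x - a) / (a' - x)⌋₊
  have hm : (m : ℝ) * (a' - x) ≤ (n + 1) * (x - a) :=
    (le_div_iff₀ hβ).1 (Nat.floor_le (by positivity))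
  have hm' : (n + 1) * (x - a) ≤ (m + 1) * (a' - x) :=
    (div_le_iff₀ hβ).1 (Nat.lt_floor_add_one _).le
  have hmr : 0 ≤ m * (r' / 2) := by positivity
  have hconv := (hLow.convPow_add hf hr.le n).lconvolution (hLow'.convPow_add hf hr'.le m) (l := r')
    (by linarith) (by linarith)
  rw [convPow_lconvolution_convPow hf] at hconv
  refine ⟨_, _, ?_, r, hr, hconv.mono le_rfl ?_⟩
  · simp [hc, hc', hr, hr']
  · push_cast
    have hdiff : |(n * 2 + 1 + (m * 2 + 1) + 1 + 1) * x -
        ((n + 1) * (2 * a) + (m + 1) * (2 * a'))| ≤ 2 * (a' - x) :=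
      abs_le.2 ⟨by linarith, by linarith⟩
    linarith

theorem exists_forall_lowerOn_convPow_mean (hf : Measurable f)
    (hlt : ∫⁻ t in Set.Iio x, f t ≠ 0) (hgt : ∫⁻ t in Set.Ioi x, f t ≠ 0) :
    ∃ (k : ℕ) (B r : ℝ), 0 < r ∧ ∀ j : ℕ, LowerOn (convPow f (j * (k + 1) + k))
      (ENNReal.ofReal (Real.exp (-(B * (j + 1))))) ((j + 1) * ((k + 1) * x)) (r * (j + 1)) := by
  obtain ⟨k, c, hc, r, hr, hLow⟩ := exists_lowerOn_convPow_mean hf hlt hgt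
  obtain ⟨b, -, hb, hbc⟩ := ENNReal.lt_iff_exists_real_btwn.1
    (show 0 < min c (c * ENNReal.ofReal (r / 2)) by simp [pos_iff_ne_zero, hc, hr])
  have hb := ENNReal.ofReal_pos.1 hb
  have hbc := le_min_iff.1 hbc.le
  refine ⟨k, -Real.log b, r / 2, by positivity, fun j =>
    (hLow.convPow_add hf hr.le j).mono ?_ ?_⟩
  · calc ENNReal.ofReal (Real.exp (-(-Real.log b * (j + 1))))
        = ENNReal.ofReal b * ENNReal.ofReal b ^ j := by
          rw [neg_mul, neg_neg, ← Nat.cast_succ, mul_comm, Real.exp_nat_mul, Real.exp_log hb,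
            ENNReal.ofReal_pow hb.le, pow_succ']
      _ ≤ c * (c * ENNReal.ofReal (r / 2)) ^ j := by
          gcongr
          · exact hbc.1
          · exact hbc.2
  · rw [sub_self, abs_zero]
    linarith

theorem tendsto_pi_abs_sum_sub_le {α : Type*} [MeasurableSpace α] {m : Measure α}
    [IsProbabilityMeasure m] {φ : α → ℝ} (hφ : Measurable φ) (hint : Integrable φ m) {ρ : ℝ}
    (hρ : 0 < ρ) :
    Tendsto (fun M : ℕ => Measure.pi (fun _ : Fin M => m)
      {w | |∑ i, φ (w i) - M * ∫ v, φ v ∂m| ≤ ρ * M}) atTop (𝓝 1) := by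
  let P := Measure.infinitePi fun _ : ℕ => m
  have heval (i : ℕ) : MeasurePreserving (Function.eval i) P m :=
    measurePreserving_eval_infinitePi _ i
  have hmean : ∫ ω, φ (ω 0) ∂P = ∫ v, φ v ∂m := by
    rw [← (heval 0).map_eq, integral_map (heval 0).aemeasurable hφ.aestronglyMeasurable]
  have hident (i : ℕ) : IdentDistrib (Function.eval i) (Function.eval 0) P P :=
    ⟨(heval i).aemeasurable, (heval 0).aemeasurable, (heval i).map_eq.trans (heval 0).map_eq.symm⟩
  have hslln := strong_law_ae_real (fun i ω => φ (ω i)) (μ := P)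
    ((heval 0).integrable_comp_of_integrable hint)
    (fun _ _ hij => (iIndepFun_infinitePi fun _ => hφ).indepFun hij) fun i => (hident i).comp hφ
  have hprob := tendstoInMeasure_iff_dist.1 (tendstoInMeasure_of_tendsto_ae
    (fun n => Measurable.aestronglyMeasurable (by fun_prop)) hslln) ρ hρ
  rw [hmean] at hprob
  have hlim : Tendsto (fun n : ℕ => 1 - P {ω | ρ ≤ dist ((∑ i ∈ Finset.range n, φ (ω i)) / n)
      (∫ v, φ v ∂m)}) atTop (𝓝 1) := by
    simpa using ENNReal.Tendsto.sub tendsto_const_nhds hprob (.inl ENNReal.one_ne_top)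
  refine tendsto_of_tendsto_of_tendsto_of_le_of_le' hlim tendsto_const_nhds ?_
    (.of_forall fun _ => prob_le_one)
  filter_upwards [eventually_gt_atTop 0] with n hn
  have hmap : Measure.pi (fun _ : Fin n => m) = P.map fun ω (i : Fin n) => ω i := by
    rw [Measure.map_infinitePi_infinitePi_of_inj Fin.val_injective, Measure.infinitePi_eq_pi]
  rw [hmap, Measure.map_apply (by fun_prop) (measurableSet_le (by fun_prop) measurable_const),
    tsub_le_iff_right, ← measure_univ (μ := P)]
  refine (measure_mono fun ω _ => ?_).trans (measure_union_le _ _)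
  refine (le_total |∑ i : Fin n, φ (ω i) - n * ∫ v, φ v ∂m| (ρ * n)).imp id fun h => ?_
  have hn' : (0 : ℝ) < n := Nat.cast_pos.2 hn
  rw [Fin.sum_univ_eq_sum_range fun i => φ (ω i)] at h
  rwa [Set.mem_ofPred, Real.dist_eq, div_sub' hn'.ne', abs_div, abs_of_pos hn', le_div_iff₀ hn']

end MeanLowerBound

section MeanDensityLowerBound

variable {G : ℝ → ℝ≥0∞} (hG : Measurable G)

include hG in
theorem setLIntegral_sqDensity {S : Set ℝ} (hS : MeasurableSet S) :
    ∫⁻ t in S, sqDensity G t = volume.withDensity G {v | v ^ 2 ∈ S} := by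
  have hpre : MeasurableSet ((fun v : ℝ => v ^ 2) ⁻¹' S) := hS.preimage (by fun_prop)
  calc ∫⁻ t in S, sqDensity G t = ∫⁻ t, sqDensity G t * S.indicator 1 t := by
        rw [← lintegral_indicator hS]
        congr with t
        by_cases ht : t ∈ S <;> simp [ht]
    _ = ∫⁻ v, ((fun v => v ^ 2) ⁻¹' S).indicator 1 v ∂volume.withDensity G :=
        (lintegral_comp_sq_withDensity hG (measurable_one.indicator hS)).symm
    _ = volume.withDensity G {v | v ^ 2 ∈ S} := lintegral_indicator_one hpre

variable [IsProbabilityMeasure (volume.withDensity G)]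

include hG in
theorem setLIntegral_Iio_sqDensity_ne_zero
    (hint : Integrable (fun v => v ^ 2) (volume.withDensity G)) :
    ∫⁻ t in Set.Iio (∫ v, v ^ 2 ∂volume.withDensity G), sqDensity G t ≠ 0 := by
  rw [Measure.restrict_congr_set Iio_ae_eq_Iic, setLIntegral_sqDensity hG measurableSet_Iic]
  exact (measure_le_integral_pos hint).ne'

include hG in
theorem setLIntegral_Ioi_sqDensity_ne_zero
    (hint : Integrable (fun v => v ^ 2) (volume.withDensity G)) :
    ∫⁻ t in Set.Ioi (∫ v, v ^ 2 ∂volume.withDensity G), sqDensity G t ≠ 0 := by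
  rw [Measure.restrict_congr_set Ioi_ae_eq_Ici, setLIntegral_sqDensity hG measurableSet_Ici]
  exact (measure_integral_le_pos hint).ne'

include hG in
theorem LowerOn.mul_pi_le_convPow {n : ℕ} {c : ℝ≥0∞} {a r : ℝ}
    (h : LowerOn (convPow (sqDensity G) n) c a r) (M : ℕ) (b : ℝ) :
    c * Measure.pi (fun _ => volume.withDensity G) {w : Fin M → ℝ | |∑ i, w i ^ 2 - b| ≤ r} ≤
      convPow (sqDensity G) (M + n) (a + b) := by
  rw [← lintegral_pi_convPow_sub_sum_sq hG, ← setLIntegral_const]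
  refine (setLIntegral_mono' (measurableSet_le (by fun_prop) measurable_const)
    fun w hw => h _ ?_).trans (setLIntegral_le_lintegral _ _)
  rwa [← abs_neg, show -(a + b - ∑ i, w i ^ 2 - a) = ∑ i, w i ^ 2 - b by ring]

include hG in
theorem exists_forall_exp_le_convPow_sqDensity
    (hint : Integrable (fun v => v ^ 2) (volume.withDensity G)) :
    ∃ (k : ℕ) (B r : ℝ), 0 < r ∧ ∀ j M : ℕ,
      2⁻¹ ≤ Measure.pi (fun _ => volume.withDensity G) {w : Fin M → ℝ |
        |∑ i, w i ^ 2 - M * ∫ v, v ^ 2 ∂volume.withDensity G| ≤ r * (j + 1)} →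
      ENNReal.ofReal (Real.exp (-(B * (j + 1)))) ≤
        convPow (sqDensity G) (M + (j * (k + 1) + k))
          (((M + (j * (k + 1) + k) : ℕ) + 1) * ∫ v, v ^ 2 ∂volume.withDensity G) := by
  obtain ⟨k, B, r, hr, hLow⟩ := exists_forall_lowerOn_convPow_mean (measurable_sqDensity hG)
    (setLIntegral_Iio_sqDensity_ne_zero hG hint) (setLIntegral_Ioi_sqDensity_ne_zero hG hint)
  refine ⟨k, B + Real.log 2, r, hr, fun j M hM => ?_⟩
  have hlog := Real.log_nonneg one_le_two
  have hhalf : Real.exp (-((B + Real.log 2) * (j + 1))) ≤ Real.exp (-(B * (j + 1))) * 2⁻¹ := by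
    rw [← Real.exp_log (inv_pos.2 two_pos : (0 : ℝ) < 2⁻¹), ← Real.exp_add, Real.log_inv]
    gcongr
    linarith [mul_nonneg hlog j.cast_nonneg]
  calc ENNReal.ofReal (Real.exp (-((B + Real.log 2) * (j + 1))))
      ≤ ENNReal.ofReal (Real.exp (-(B * (j + 1))) * 2⁻¹) := ENNReal.ofReal_le_ofReal hhalf
    _ = ENNReal.ofReal (Real.exp (-(B * (j + 1)))) * 2⁻¹ := by
        rw [ENNReal.ofReal_mul (Real.exp_pos _).le, ENNReal.ofReal_inv_of_pos two_pos,
          ENNReal.ofReal_ofNat]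
    _ ≤ _ := (mul_le_mul_right hM _).trans ((hLow j).mul_pi_le_convPow hG M _)
    _ = _ := by
        congr 1
        push_cast
        ring

theorem eventually_exists_eq_add_mul_add (k M₀ : ℕ) {δ : ℝ} (hδ : 0 < δ)
    (hk : (k + 1) * δ ≤ 1 / 2) :
    ∀ᶠ n : ℕ in atTop, ∃ j M : ℕ, M₀ ≤ M ∧ n = M + (j * (k + 1) + k) ∧ j ≤ δ * n ∧
      δ * n ≤ j + 1 := by
  filter_upwards [eventually_ge_atTop (2 * (k + M₀))] with n hn
  have hj : (⌊δ * n⌋₊ : ℝ) ≤ δ * n := Nat.floor_le (by positivity)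
  have hjn : M₀ + (⌊δ * n⌋₊ * (k + 1) + k) ≤ n := by
    rify at hn ⊢
    have : (⌊δ * n⌋₊ : ℝ) * (k + 1) ≤ 1 / 2 * n := by
      calc (⌊δ * n⌋₊ : ℝ) * (k + 1) ≤ δ * n * (k + 1) := by gcongr
        _ = (k + 1) * δ * n := by ring
        _ ≤ 1 / 2 * n := by gcongr
    linarith
  exact ⟨⌊δ * n⌋₊, n - (⌊δ * n⌋₊ * (k + 1) + k), by omega, by omega, hj,
    (Nat.lt_floor_add_one _).le⟩

include hG in
theorem eventually_exp_le_convPow_sqDensity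
    (hint : Integrable (fun v => v ^ 2) (volume.withDensity G)) {ε : ℝ} (hε : 0 < ε) :
    ∀ᶠ n : ℕ in atTop, ENNReal.ofReal (Real.exp (-(ε * n))) ≤
      convPow (sqDensity G) n ((n + 1) * ∫ v, v ^ 2 ∂volume.withDensity G) := by
  obtain ⟨k, B, r, hr, hexp⟩ := exists_forall_exp_le_convPow_sqDensity hG hint
  -- A fraction `δ` of the coordinates provides the density; the law of large numbers for the
  -- remaining ones keeps the target within its reach.
  obtain ⟨δ, hδ, h⟩ := exists_pos_mul_lt (show 0 < min (ε / 2) (1 / 2) by positivity)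
    (|B| + (k + 1))
  obtain ⟨hδε, hδk⟩ := lt_min_iff.1 h
  have hBδ := mul_nonneg (abs_nonneg B) hδ.le
  have hkδ : 0 ≤ (k + 1) * δ := by positivity
  obtain ⟨M₀, hM₀⟩ := eventually_atTop.1 ((tendsto_pi_abs_sum_sub_le (by fun_prop) hint
    (mul_pos hr hδ)).eventually_const_le ENNReal.one_half_lt_one)
  filter_upwards [eventually_exists_eq_add_mul_add k M₀ hδ (by linarith),
    tendsto_natCast_atTop_atTop.eventually_ge_atTop (2 * |B| / ε)]
    with n ⟨j, M, hM, hn, hj, hj'⟩ hn'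
  have hρ : r * δ * M ≤ r * (j + 1) := by
    calc r * δ * M ≤ r * δ * n := by
          gcongr
          omega
      _ ≤ r * (j + 1) := by
          rw [mul_assoc]
          gcongr
  have hB : B * (j + 1) ≤ ε * n := by
    rw [div_le_iff₀ hε] at hn'
    calc B * (j + 1) ≤ |B| * (δ * n + 1) := by
          gcongr
          exact le_abs_self B
      _ = |B| * δ * n + |B| := by ring
      _ ≤ ε / 2 * n + |B| := by
          gcongr
          linarith
      _ ≤ ε * n := by linarith
  calc ENNReal.ofReal (Real.exp (-(ε * n)))
      ≤ ENNReal.ofReal (Real.exp (-(B * (j + 1)))) := by gcongr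
    _ ≤ _ := hexp j M ((hM₀ M hM).trans
      (measure_mono (Set.ofPred_subset_ofPred.2 fun w hw => hw.trans hρ)))
    _ = _ := by rw [← hn]

end MeanDensityLowerBound

section Domination

variable {g : ℝ → ℝ}

theorem lintegral_condTensor (hg : Measurable g) {N : ℕ} {F : KacSphere N → ℝ≥0∞}
    (hF : Measurable F) :
    ∫⁻ v, F v ∂condTensor g N =
      (partitionFn g N)⁻¹ * ∫⁻ v, (∏ j, ENNReal.ofReal (g (v.1 j))) * F v ∂uniformSphere N := by
  have hprod : Measurable fun v : KacSphere N => ∏ j, ENNReal.ofReal (g (v.1 j)) := by fun_prop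
  simp only [condTensor, div_eq_mul_inv]
  rw [lintegral_withDensity_eq_lintegral_mul _ (hprod.mul_const _) hF,
    ← lintegral_const_mul _ (f := fun v => (∏ j, ENNReal.ofReal (g (v.1 j))) * F v)
      (hprod.mul hF)]
  refine lintegral_congr fun v => ?_
  simp only [Pi.mul_apply]
  ring

theorem isProbabilityMeasure_condTensor (hg : Measurable g) {N : ℕ}
    (h0 : partitionFn g N ≠ 0) (htop : partitionFn g N ≠ ∞) :
    IsProbabilityMeasure (condTensor g N) := by
  have htotal := lintegral_condTensor hg (N := N) (F := fun _ => 1) measurable_const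
  simp only [lintegral_const, one_mul, mul_one] at htotal
  exact ⟨htotal.trans (ENNReal.inv_mul_cancel h0 htop)⟩

theorem map_firstCoords_condTensor_le (hg : Measurable g) {k N : ℕ} {m : Measure (Fin k → ℝ)}
    {c : ℝ≥0∞} (hle : ∀ R : (Fin k → ℝ) → ℝ≥0∞, Measurable R →
      ∫⁻ v : KacSphere N, (∏ j, ENNReal.ofReal (g (v.1 j))) * R (firstCoords k N v)
        ∂uniformSphere N ≤ c * ∫⁻ y, R y ∂m) :
    (condTensor g N).map (firstCoords k N) ≤ ((partitionFn g N)⁻¹ * c) • m := by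
  refine Measure.le_iff.2 fun s hs => ?_
  have hind : Measurable (s.indicator (1 : (Fin k → ℝ) → ℝ≥0∞)) := measurable_one.indicator hs
  rw [← lintegral_indicator_one hs, lintegral_map hind (measurable_firstCoords k N),
    lintegral_condTensor hg (F := fun v => s.indicator 1 (firstCoords k N v))
      (hind.comp (measurable_firstCoords k N)),
    Measure.smul_apply, smul_eq_mul, ← lintegral_indicator_one hs, mul_assoc]
  gcongr
  exact hle _ hind

theorem exists_forall_lintegral_prod_mul_firstCoords_le (hg : Measurable g)
    [SigmaFinite (volume.withDensity fun v => ENNReal.ofReal (g v))] {d : ℕ} (hd : d ≠ 0)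
    (hgd : ∫⁻ t, ENNReal.ofReal (g t) ^ (1 + 2 / (d : ℝ)) ≠ ∞) :
    ∃ C ≠ ∞, ∀ N : ℕ, ∀ R : (Fin N → ℝ) → ℝ≥0∞, Measurable R →
      ∫⁻ v : KacSphere (N + (d + 2)), (∏ j, ENNReal.ofReal (g (v.1 j))) *
          R (firstCoords N (N + (d + 2)) v) ∂uniformSphere (N + (d + 2)) ≤
        sphereConst (N + (d + 1)) * (C *
          ∫⁻ y, R y ∂Measure.pi fun _ => volume.withDensity fun v => ENNReal.ofReal (g v)) := by
  refine ⟨(d + 2 : ℕ) * ((d + 1 : ℕ) * (ENNReal.ofReal (2 * Real.pi) *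
    (∫⁻ t, ENNReal.ofReal (g t) ^ (1 + 2 / (d : ℝ))) ^ d)), by finiteness, fun N R hR => ?_⟩
  have hfirst : ∀ v, firstCoords N (N + (d + 2)) v = fun j => v.1 (Fin.castAdd (d + 2) j) :=
    fun v => funext fun j => dif_pos (j.2.trans_le (Nat.le_add_right N (d + 2)))
  simp only [hfirst]
  exact lintegral_uniformSphere_prod_mul_le hg.ennreal_ofReal hd hR

variable {ε : ℝ}

theorem eventually_le_partitionFn (hg : Measurable g)
    [IsProbabilityMeasure (volume.withDensity fun v => ENNReal.ofReal (g v))]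
    (hint : Integrable (fun v => v ^ 2) (volume.withDensity fun v => ENNReal.ofReal (g v)))
    (hmean : ∫ v, v ^ 2 ∂(volume.withDensity fun v => ENNReal.ofReal (g v)) = 1) (hε : 0 < ε) :
    ∀ᶠ n : ℕ in atTop,
      sphereConst n * ENNReal.ofReal (Real.exp (-(ε * n))) ≤ partitionFn g (n + 1) := by
  filter_upwards [eventually_exp_le_convPow_sqDensity hg.ennreal_ofReal hint hε] with n hn
  rw [partitionFn, lintegral_uniformSphere_prod hg.ennreal_ofReal]
  rw [hmean, mul_one] at hn
  gcongr
  calc _ ≤ _ := hn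
    _ ≤ _ := by
      push_cast
      exact le_mul_of_one_le_left' one_le_two

theorem eventually_const_le_ofReal_exp {C : ℝ≥0∞} (hC : C ≠ ∞) (hε : 0 < ε) (b : ℝ) :
    ∀ᶠ N : ℕ in atTop, C ≤ ENNReal.ofReal (Real.exp (ε * N + b)) := by
  have hexp : Tendsto (fun N : ℕ => Real.exp (ε * N + b)) atTop atTop :=
    Real.tendsto_exp_atTop.comp (tendsto_atTop_add_const_right _ _
      (tendsto_natCast_atTop_atTop.const_mul_atTop hε))
  filter_upwards [hexp.eventually_ge_atTop C.toReal] with N hN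
  exact (ENNReal.le_ofReal_iff_toReal_le hC (Real.exp_pos _).le).2 hN

theorem eventually_map_firstCoords_condTensor_le (hg : Measurable g)
    [IsProbabilityMeasure (volume.withDensity fun v => ENNReal.ofReal (g v))]
    (hint : Integrable (fun v => v ^ 2) (volume.withDensity fun v => ENNReal.ofReal (g v)))
    (hmean : ∫ v, v ^ 2 ∂(volume.withDensity fun v => ENNReal.ofReal (g v)) = 1)
    {d : ℕ} (hd : d ≠ 0) (hgd : ∫⁻ t, ENNReal.ofReal (g t) ^ (1 + 2 / (d : ℝ)) ≠ ∞)
    (hε : 0 < ε) :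
    ∀ᶠ N : ℕ in atTop, IsProbabilityMeasure (condTensor g (N + (d + 2))) ∧
      (condTensor g (N + (d + 2))).map (firstCoords N (N + (d + 2))) ≤
        ENNReal.ofReal (Real.exp (ε * N)) •
          Measure.pi fun _ => volume.withDensity fun v => ENNReal.ofReal (g v) := by
  obtain ⟨C, hC, hle⟩ := exists_forall_lintegral_prod_mul_firstCoords_le hg hd hgd
  filter_upwards [(tendsto_add_atTop_nat (d + 1)).eventually
      (eventually_le_partitionFn hg hint hmean (half_pos hε)),
    eventually_const_le_ofReal_exp hC (half_pos hε) (-(ε / 2 * (d + 1)))] with N hlow hCN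
  set κ := sphereConst (N + (d + 1))
  set x := ENNReal.ofReal (Real.exp (-(ε / 2 * (N + (d + 1) : ℕ))))
  have hκ0 : κ ≠ 0 := sphereConst_ne_zero _
  have hκ : κ ≠ ∞ := sphereConst_ne_top _
  have hx0 : x ≠ 0 := (ENNReal.ofReal_pos.2 (Real.exp_pos _)).ne'
  have hZ0 : partitionFn g (N + (d + 2)) ≠ 0 :=
    ((ENNReal.mul_pos hκ0 hx0).trans_le hlow).ne'
  have hZ : partitionFn g (N + (d + 2)) ≠ ∞ := by
    have htotal := hle N (fun _ => 1) measurable_const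
    simp only [mul_one, lintegral_const, measure_univ] at htotal
    exact ne_top_of_le_ne_top (ENNReal.mul_ne_top hκ hC) htotal
  have hCx : C / x ≤ ENNReal.ofReal (Real.exp (ε * N)) := by
    rw [ENNReal.div_le_iff hx0 ENNReal.ofReal_ne_top,
      ← ENNReal.ofReal_mul (Real.exp_pos _).le, ← Real.exp_add]
    convert hCN using 3
    push_cast
    ring
  refine ⟨isProbabilityMeasure_condTensor hg hZ0 hZ, (map_firstCoords_condTensor_le hg
    (c := κ * C) fun R hR => (hle N R hR).trans_eq (mul_assoc _ _ _).symm).trans ?_⟩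
  gcongr
  calc (partitionFn g (N + (d + 2)))⁻¹ * (κ * C) ≤ (κ * x)⁻¹ * (κ * C) := by
        gcongr
        exact hlow
    _ = κ * C / (κ * x) := by rw [mul_comm, div_eq_mul_inv]
    _ = C / x := ENNReal.mul_div_mul_left _ _ hκ0 hκ
    _ ≤ ENNReal.ofReal (Real.exp (ε * N)) := hCx

end Domination

section EntropyInequality

open InformationTheory

section Variational

variable {α : Type*} [MeasurableSpace α] {μ π : Measure α} [IsProbabilityMeasure μ]
  [IsProbabilityMeasure π]

theorem integral_le_toReal_klDiv_add_log_integral_exp (hkl : klDiv μ π ≠ ∞) {F : α → ℝ}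
    (hFμ : Integrable F μ) (hFπ : Integrable (fun x => Real.exp (F x)) π) :
    ∫ x, F x ∂μ ≤ (klDiv μ π).toReal + Real.log (∫ x, Real.exp (F x) ∂π) := by
  obtain ⟨hac, hllr⟩ := klDiv_ne_top_iff.1 hkl
  have : IsProbabilityMeasure (π.tilted F) := isProbabilityMeasure_tilted hFπ
  have hac_tilted : μ ≪ π.tilted F := hac.trans (absolutelyContinuous_tilted hFπ)
  have hgibbs := integral_llr_add_sub_measure_univ_nonneg hac_tilted
    (integrable_llr_tilted_right hac hFμ hllr hFπ)
  rw [integral_llr_tilted_right hac hFμ hFπ hllr] at hgibbs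
  rw [toReal_klDiv_of_measure_eq hac (by simp only [measure_univ])]
  simp only [probReal_univ] at hgibbs
  linarith

theorem mul_integral_le_toReal_klDiv_add {P : Measure α} {x : ℝ}
    (hle : π ≤ ENNReal.ofReal (Real.exp x) • P) (hkl : klDiv μ π ≠ ∞) {F : α → ℝ}
    (hFμ : Integrable F μ) {c : NNReal} (hF : HasSubgaussianMGF F c P) (t : ℝ) :
    t * ∫ a, F a ∂μ ≤ (klDiv μ π).toReal + (x + c * t ^ 2 / 2) := by
  have hexpP : Integrable (fun a => Real.exp (t * F a)) (ENNReal.ofReal (Real.exp x) • P) :=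
    (hF.integrable_exp_mul t).smul_measure ENNReal.ofReal_ne_top
  have hexp : Integrable (fun a => Real.exp (t * F a)) π := hexpP.mono_measure hle
  have hmoment : ∫ a, Real.exp (t * F a) ∂π ≤ Real.exp (x + c * t ^ 2 / 2) := by
    calc _ ≤ ∫ a, Real.exp (t * F a) ∂(ENNReal.ofReal (Real.exp x) • P) :=
          integral_mono_measure hle (ae_of_all _ fun _ => (Real.exp_pos _).le) hexpP
      _ = Real.exp x * mgf F P t := by
          rw [integral_smul_measure, ENNReal.toReal_ofReal (Real.exp_pos x).le, smul_eq_mul, mgf]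
      _ ≤ _ := by
          rw [Real.exp_add]
          gcongr
          exact hF.mgf_le t
  calc t * ∫ a, F a ∂μ = ∫ a, t * F a ∂μ := (integral_const_mul _ _).symm
    _ ≤ (klDiv μ π).toReal + Real.log (∫ a, Real.exp (t * F a) ∂π) :=
        integral_le_toReal_klDiv_add_log_integral_exp hkl (hFμ.const_mul t) hexp
    _ ≤ (klDiv μ π).toReal + (x + c * t ^ 2 / 2) := by
        gcongr
        exact (Real.log_le_iff_le_exp (integral_exp_pos hexp)).2 hmoment

end Variational

theorem iIndepFun_curry {ι κ Ω E : Type*} [MeasurableSpace Ω] [MeasurableSpace E]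
    {P : Measure Ω} {X : ι × κ → Ω → E} (hX : ∀ p, Measurable (X p)) (h : iIndepFun X P) :
    iIndepFun (fun i ω j => X (i, j) ω) P := by
  have := h.isProbabilityMeasure
  have : ∀ p, IsProbabilityMeasure (P.map (X p)) := fun p =>
    Measure.isProbabilityMeasure_map (hX p).aemeasurable
  have hrow : ∀ i, P.map (fun ω j => X (i, j) ω) = Measure.infinitePi fun j => P.map (X (i, j)) :=
    fun i => (h.precomp (Prod.mk_right_injective i)).map_fun_eq_infinitePi_map fun j => hX (i, j)
  rw [iIndepFun_iff_map_fun_eq_infinitePi_map (by fun_prop)]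
  simp only [hrow]
  rw [← Measure.infinitePi_map_curry fun i j => P.map (X (i, j)),
    ← h.map_fun_eq_infinitePi_map hX, Measure.map_map (by fun_prop) (by fun_prop)]
  rfl

section Blocks

variable {ι κ β E : Type*} [Fintype ι] [Fintype κ] [Fintype β] [MeasurableSpace E] {m : Measure E}
  [IsProbabilityMeasure m] {e : β × κ → ι} {φ : (κ → E) → ℝ} {B : ℝ}

theorem map_precomp_pi {f : κ → ι} (hf : Function.Injective f) :
    (Measure.pi fun _ : ι => m).map (fun z j => z (f j)) = Measure.pi fun _ : κ => m := by
  have hind : iIndepFun (fun j (z : ι → E) => z (f j)) (Measure.pi fun _ : ι => m) :=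
    (iIndepFun_pi (X := fun _ x => x) fun _ => aemeasurable_id).precomp hf
  rw [(iIndepFun_iff_map_fun_eq_pi_map fun j => (measurable_pi_apply (f j)).aemeasurable).1 hind]
  simp only [(measurePreserving_eval (fun _ : ι => m) _).map_eq]

theorem hasSubgaussianMGF_sum_blocks_sub_integral (he : Function.Injective e)
    (hφ : Measurable φ) (hB : ∀ x, |φ x| ≤ B) :
    HasSubgaussianMGF
      (fun z : ι → E => ∑ b, (φ (fun j => z (e (b, j))) - ∫ x, φ x ∂Measure.pi fun _ => m))
      (Fintype.card β * ‖B‖₊ ^ 2) (Measure.pi fun _ => m) := by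
  set a := ∫ x, φ x ∂Measure.pi fun _ => m
  have hcoord : iIndepFun (fun p (z : ι → E) => z (e p)) (Measure.pi fun _ : ι => m) :=
    (iIndepFun_pi (X := fun _ x => x) fun _ => aemeasurable_id).precomp he
  have hind := (iIndepFun_curry (fun p => measurable_pi_apply (e p)) hcoord).comp
    (fun _ x => φ x - a) fun _ => hφ.sub_const _
  have hhoeffding : HasSubgaussianMGF (fun x => φ x - a)
      (‖B‖₊ ^ 2) (Measure.pi fun _ : κ => m) := by
    convert hasSubgaussianMGF_of_mem_Icc hφ.aemeasurable
      (ae_of_all (Measure.pi fun _ => m) fun x => abs_le.1 (hB x)) using 2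
    rw [sub_neg_eq_add, ← two_mul, nnnorm_mul, Real.nnnorm_ofNat,
      mul_div_cancel_left₀ _ two_ne_zero]
  have hblock : ∀ b, HasSubgaussianMGF
      (fun z : ι → E => φ (fun j => z (e (b, j))) - a)
      (‖B‖₊ ^ 2) (Measure.pi fun _ => m) := fun b => by
    have hlaw := map_precomp_pi (m := m) (f := fun j => e (b, j))
      (he.comp (Prod.mk_right_injective b))
    exact (hlaw.symm ▸ hhoeffding :).of_map (Measurable.aemeasurable (by fun_prop))
  convert! HasSubgaussianMGF.sum_of_iIndepFun hind fun b (_ : b ∈ Finset.univ) => hblock b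
  rw [Finset.sum_const, Finset.card_univ, nsmul_eq_mul]

theorem mul_integral_sub_integral_pi_le {ρ π : Measure (ι → E)} [IsProbabilityMeasure ρ]
    [IsProbabilityMeasure π] {ρ' : Measure (κ → E)}
    (he : Function.Injective e) (hρ : ∀ b, ρ.map (fun z j => z (e (b, j))) = ρ') {x : ℝ}
    (hle : π ≤ ENNReal.ofReal (Real.exp x) • Measure.pi fun _ => m) (hkl : klDiv ρ π ≠ ∞)
    (hφ : Measurable φ) (hB : ∀ x, |φ x| ≤ B) (t : ℝ) :
    t * (Fintype.card β * (∫ y, φ y ∂ρ' - ∫ y, φ y ∂Measure.pi fun _ => m)) ≤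
      (klDiv ρ π).toReal + (x + Fintype.card β * B ^ 2 * t ^ 2 / 2) := by
  set a := ∫ y, φ y ∂Measure.pi fun _ => m
  have hmeas : ∀ b, Measurable fun (z : ι → E) j => z (e (b, j)) := fun b => by fun_prop
  have hint : ∀ b, Integrable (fun z : ι → E => φ fun j => z (e (b, j))) ρ := fun b =>
    Integrable.of_bound (hφ.comp (hmeas b)).aestronglyMeasurable B (ae_of_all _ fun z => hB _)
  have hint_sub : ∀ b, Integrable (fun z : ι → E => φ (fun j => z (e (b, j))) - a) ρ := fun b =>
    (hint b).sub (integrable_const a)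
  have hterm : ∀ b, ∫ z, φ (fun j => z (e (b, j))) ∂ρ = ∫ y, φ y ∂ρ' := fun b => by
    rw [← hρ b, integral_map (hmeas b).aemeasurable hφ.aestronglyMeasurable]
  have hsum : ∫ z, ∑ b, (φ (fun j => z (e (b, j))) - a) ∂ρ =
      Fintype.card β * (∫ y, φ y ∂ρ' - a) := by
    rw [integral_finsetSum _ fun b _ => hint_sub b]
    simp_rw [integral_sub (hint _) (integrable_const a), hterm, integral_const, probReal_univ,
      one_smul, Finset.sum_const, Finset.card_univ, nsmul_eq_mul]
  have hent := mul_integral_le_toReal_klDiv_add hle hkl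
    (integrable_finsetSum _ fun b _ => hint_sub b)
    (hasSubgaussianMGF_sum_blocks_sub_integral he hφ hB) t
  rw [hsum] at hent
  simpa only [NNReal.coe_mul, NNReal.coe_natCast, NNReal.coe_pow, coe_nnnorm, Real.norm_eq_abs,
    sq_abs] using hent

end Blocks

end EntropyInequality

section Chaos

open InformationTheory

variable {k N : ℕ}

theorem measurable_permute (τ : Equiv.Perm (Fin N)) : Measurable (permute τ) :=
  Measurable.subtype_mk (by fun_prop)

theorem firstCoords_apply (h : k ≤ N) (v : KacSphere N) (i : Fin k) :
    firstCoords k N v i = v.1 (Fin.castLE h i) :=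
  dif_pos (i.2.trans_le h)

theorem IsSymmetric.map_coords_eq_map_firstCoords {μ : Measure (KacSphere N)} (hμ : IsSymmetric μ)
    {f : Fin k → Fin N} (hf : Function.Injective f) :
    μ.map (fun v i => v.1 (f i)) = μ.map (firstCoords k N) := by
  have hkN : k ≤ N := by simpa only [Fintype.card_fin] using Fintype.card_le_of_injective f hf
  obtain ⟨τ, hτ⟩ := Equiv.Perm.exists_extending_pair (Fin.castLE hkN) f
    (Fin.castLE_injective hkN) hf
  have hcomp : firstCoords k N ∘ permute τ = fun v i => v.1 (f i) := by
    funext v i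
    rw [Function.comp_apply, firstCoords_apply hkN, ← hτ]
    rfl
  rw [← hcomp, ← Measure.map_map (measurable_firstCoords k N) (measurable_permute τ), hμ τ]

variable {φ : (Fin k → ℝ) → ℝ} {B : ℝ}

theorem mul_integral_marginal_sub_integral_pi_le {M L : ℕ} (hNM : N ≤ M) (hL : L * k ≤ N)
    {μ : ProbabilityMeasure (KacSphere M)} (hμ : IsSymmetric (μ : Measure (KacSphere M)))
    {π : Measure (KacSphere M)} [IsProbabilityMeasure π] {m : Measure ℝ} [IsProbabilityMeasure m]
    {x y : ℝ} (hle : π.map (firstCoords N M) ≤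
      ENNReal.ofReal (Real.exp x) • Measure.pi fun _ => m)
    (hy : 0 ≤ y) (hkl : klDiv (μ : Measure (KacSphere M)) π ≤ ENNReal.ofReal y)
    (hφ : Measurable φ) (hB : ∀ z, |φ z| ≤ B) (t : ℝ) :
    t * (L * (∫ z, φ z ∂(marginal k μ : Measure (Fin k → ℝ)) -
      ∫ z, φ z ∂Measure.pi fun _ => m)) ≤ y + (x + L * B ^ 2 * t ^ 2 / 2) := by
  have hfirst := measurable_firstCoords N M
  have : IsProbabilityMeasure ((μ : Measure (KacSphere M)).map (firstCoords N M)) :=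
    Measure.isProbabilityMeasure_map hfirst.aemeasurable
  have : IsProbabilityMeasure (π.map (firstCoords N M)) :=
    Measure.isProbabilityMeasure_map hfirst.aemeasurable
  set e : Fin L × Fin k → Fin N := fun p => Fin.castLE hL (finProdFinEquiv p)
  have he : Function.Injective e := (Fin.castLE_injective hL).comp finProdFinEquiv.injective
  have hblock : ∀ b, ((μ : Measure (KacSphere M)).map (firstCoords N M)).map
      (fun z j => z (e (b, j))) = (marginal k μ : Measure (Fin k → ℝ)) := fun b => by
    have hinj : Function.Injective fun j => Fin.castLE hNM (e (b, j)) :=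
      (Fin.castLE_injective hNM).comp (he.comp (Prod.mk_right_injective b))
    rw [Measure.map_map (by fun_prop) hfirst]
    calc _ = (μ : Measure (KacSphere M)).map fun v j => v.1 (Fin.castLE hNM (e (b, j))) := by
          congr 1
          funext v j
          exact firstCoords_apply hNM v _
      _ = (μ : Measure (KacSphere M)).map (firstCoords k M) :=
          hμ.map_coords_eq_map_firstCoords hinj
  have hdata : klDiv ((μ : Measure (KacSphere M)).map (firstCoords N M))
      (π.map (firstCoords N M)) ≤ ENNReal.ofReal y := (klDiv_map_le _ _ hfirst).trans hkl
  have hent := mul_integral_sub_integral_pi_le he hblock hle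
    (ne_top_of_le_ne_top ENNReal.ofReal_ne_top hdata) hφ hB t
  rw [Fintype.card_fin] at hent
  exact hent.trans (by gcongr; exact ENNReal.toReal_le_of_le_ofReal hy hdata)

theorem eventually_add_le_two_mul_mul_div (hk : k ≠ 0) (c : ℕ) :
    ∀ᶠ N : ℕ in atTop, N + c ≤ 2 * k * (N / k) := by
  filter_upwards [eventually_ge_atTop (2 * k + c)] with N hN
  have hdiv : N < k * (N / k + 1) := Nat.lt_mul_div_succ N hk.pos
  nlinarith

theorem eventually_le_ofReal_mul_of_tendsto_div {a : ℕ → ℝ≥0∞}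
    (ha : Tendsto (fun N : ℕ => a N / (N : ℝ≥0∞)) atTop (𝓝 0)) {ε : ℝ} (hε : 0 < ε) :
    ∀ᶠ N : ℕ in atTop, a N ≤ ENNReal.ofReal (ε * N) := by
  filter_upwards [ha.eventually_lt_const (ENNReal.ofReal_pos.2 hε),
    eventually_ne_atTop 0] with N hN hN0
  rw [ENNReal.div_lt_iff (.inl (Nat.cast_ne_zero.2 hN0)) (.inl (ENNReal.natCast_ne_top N))] at hN
  rw [ENNReal.ofReal_mul hε.le, ENNReal.ofReal_natCast]
  exact hN.le

section Marginals

variable {g : ℝ → ℝ} {d : ℕ} {μ : ∀ N : ℕ, ProbabilityMeasure (KacSphere N)}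

theorem eventually_integral_marginal_le_add_add (hg : Measurable g)
    [IsProbabilityMeasure (volume.withDensity fun v => ENNReal.ofReal (g v))]
    (hint : Integrable (fun v => v ^ 2) (volume.withDensity fun v => ENNReal.ofReal (g v)))
    (hmean : ∫ v, v ^ 2 ∂(volume.withDensity fun v => ENNReal.ofReal (g v)) = 1)
    (hd : d ≠ 0) (hgd : ∫⁻ t, ENNReal.ofReal (g t) ^ (1 + 2 / (d : ℝ)) ≠ ∞)
    (hμ : ∀ N, 1 ≤ N → IsSymmetric (μ N : Measure (KacSphere N)))
    (hkl : Tendsto (fun N : ℕ => klDiv (μ N : Measure (KacSphere N)) (condTensor g N) /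
      (N : ℝ≥0∞)) atTop (𝓝 0))
    (hk : k ≠ 0) (hφ : Measurable φ) (hB : ∀ z, |φ z| ≤ B) {t η : ℝ} (ht : 0 < t) (hη : 0 < η) :
    ∀ᶠ N in atTop, ∫ z, φ z ∂(marginal k (μ N) : Measure (Fin k → ℝ)) ≤
      ∫ z, φ z ∂(Measure.pi fun _ => volume.withDensity fun v => ENNReal.ofReal (g v)) +
        (η + B ^ 2 * t / 2) := by
  set ε := t * η / (4 * k)
  have hε : 0 < ε := by positivity
  rw [← map_add_atTop_eq_nat (d + 2), eventually_map]
  filter_upwards [eventually_map_firstCoords_condTensor_le hg hint hmean hd hgd hε,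
    (tendsto_add_atTop_nat (d + 2)).eventually (eventually_le_ofReal_mul_of_tendsto_div hkl hε),
    eventually_add_le_two_mul_mul_div hk (d + 2)] with N ⟨_, hle⟩ hent hNL
  have hbound := mul_integral_marginal_sub_integral_pi_le (Nat.le_add_right N (d + 2))
    (Nat.div_mul_le_self N k) (hμ _ (by lia)) hle (by positivity) hent hφ hB t
  set L := N / k
  have hL : 0 < (L : ℝ) := by
    exact_mod_cast Nat.pos_of_mul_pos_left (lt_of_lt_of_le (by lia) hNL)
  have hNL' : ((N + (d + 2) : ℕ) : ℝ) ≤ 2 * k * L := by exact_mod_cast hNL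
  have hN : (N : ℝ) ≤ 2 * k * L := (Nat.cast_le.2 (Nat.le_add_right N (d + 2))).trans hNL'
  rw [← sub_le_iff_le_add']
  refine le_of_mul_le_mul_left ?_ (mul_pos ht hL)
  rw [mul_assoc]
  calc _ ≤ ε * (N + (d + 2) : ℕ) + (ε * N + L * B ^ 2 * t ^ 2 / 2) := hbound
    _ ≤ ε * (2 * k * L) + (ε * (2 * k * L) + L * B ^ 2 * t ^ 2 / 2) := by gcongr
    _ = t * L * (η + B ^ 2 * t / 2) := by
      simp only [ε]
      field_simp
      ring

theorem tendsto_marginal_tensorPower (hg : Measurable g) {ν : ProbabilityMeasure ℝ}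
    (hν : (ν : Measure ℝ) = volume.withDensity fun v => ENNReal.ofReal (g v))
    (hint : Integrable (fun v => v ^ 2) (ν : Measure ℝ)) (hmean : ∫ v, v ^ 2 ∂(ν : Measure ℝ) = 1)
    (hd : d ≠ 0) (hgd : ∫⁻ t, ENNReal.ofReal (g t) ^ (1 + 2 / (d : ℝ)) ≠ ∞)
    (hμ : ∀ N, 1 ≤ N → IsSymmetric (μ N : Measure (KacSphere N)))
    (hkl : Tendsto (fun N : ℕ => klDiv (μ N : Measure (KacSphere N)) (condTensor g N) /
      (N : ℝ≥0∞)) atTop (𝓝 0))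
    (hk : k ≠ 0) :
    Tendsto (fun N => marginal k (μ N)) atTop (𝓝 (tensorPower ν k)) := by
  rw [ProbabilityMeasure.tendsto_iff_forall_integral_tendsto]
  intro φ
  have hcoe : (tensorPower ν k : Measure (Fin k → ℝ)) =
      Measure.pi fun _ => volume.withDensity fun v => ENNReal.ofReal (g v) := by
    rw [← hν]
    rfl
  have : IsProbabilityMeasure (volume.withDensity fun v => ENNReal.ofReal (g v)) :=
    hν ▸ inferInstance
  rw [hν] at hint hmean
  rw [hcoe, Metric.tendsto_nhds]
  intro δ hδ
  set t := δ / (‖φ‖ ^ 2 + 1)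
  have ht : 0 < t := by positivity
  have hφt : ‖φ‖ ^ 2 * t ≤ δ := by
    rw [mul_div_assoc', div_le_iff₀ (by positivity)]
    linarith
  have hφ : Measurable φ := φ.continuous.measurable
  have hle {ψ : (Fin k → ℝ) → ℝ} (hψ : Measurable ψ) (hB : ∀ z, |ψ z| ≤ ‖φ‖) :=
    eventually_integral_marginal_le_add_add hg hint hmean hd hgd hμ hkl hk hψ hB ht
      (show 0 < δ / 4 by positivity)
  filter_upwards [hle hφ φ.norm_coe_le_norm,
    hle hφ.neg fun z => (abs_neg _).trans_le (φ.norm_coe_le_norm z)] with N hupper hlower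
  simp only [Pi.neg_apply, integral_neg] at hlower
  rw [Real.dist_eq, abs_lt]
  constructor <;> linarith

end Marginals

theorem integrable_of_isFiniteMeasure_withDensity {α : Type*} [MeasurableSpace α]
    {m : Measure α} {g : α → ℝ} (hg : Measurable g) (hg_nonneg : ∀ x, 0 ≤ g x)
    [IsFiniteMeasure (m.withDensity fun x => ENNReal.ofReal (g x))] : Integrable g m := by
  have htotal := measure_lt_top (m.withDensity fun x => ENNReal.ofReal (g x)) Set.univ
  rw [withDensity_apply _ .univ, setLIntegral_univ] at htotal
  exact ⟨hg.aestronglyMeasurable, (hasFiniteIntegral_iff_ofReal (ae_of_all _ hg_nonneg)).2 htotal⟩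

end Chaos

end KacChaos

theorem mainTheorem7_general
    (g : ℝ → ℝ) (hg_meas : Measurable g) (hg_nonneg : ∀ v, 0 ≤ g v)
    (ν : ProbabilityMeasure ℝ)
    (hν : (ν : Measure ℝ) = volume.withDensity (fun v => ENNReal.ofReal (g v)))
    (h2 : ∫ v, g v * v ^ 2 = 1)
    (p : ENNReal) (hp : 1 < p) (hgp : MemLp g p)
    (μ : ∀ N : ℕ, ProbabilityMeasure (KacChaos.KacSphere N))
    (hμ_symm : ∀ N, 1 ≤ N → KacChaos.IsSymmetric (μ N : Measure (KacChaos.KacSphere N)))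
    (hμ_entropy : Tendsto
      (fun N : ℕ => InformationTheory.klDiv
        (μ N : Measure (KacChaos.KacSphere N)) (KacChaos.condTensor g N) / (N : ENNReal))
      atTop (𝓝 0)) :
    KacChaos.IsChaotic ν μ := by
  have hG : Measurable fun v => ENNReal.ofReal (g v) := hg_meas.ennreal_ofReal
  have hG_lt_top : ∀ᵐ v, ENNReal.ofReal (g v) < ∞ := ae_of_all _ fun _ => ENNReal.ofReal_lt_top
  have hsq : (fun v => (ENNReal.ofReal (g v)).toReal • v ^ 2) = fun v => g v * v ^ 2 :=
    funext fun v => by rw [ENNReal.toReal_ofReal (hg_nonneg v), smul_eq_mul]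
  have hsq_int : Integrable (fun v => v ^ 2) (ν : Measure ℝ) := by
    rw [hν, integrable_withDensity_iff_integrable_smul' hG hG_lt_top, hsq]
    exact not_imp_comm.1 integral_undef (h2.trans_ne one_ne_zero)
  have hsq_mean : ∫ v, v ^ 2 ∂(ν : Measure ℝ) = 1 := by
    rw [hν, integral_withDensity_eq_integral_toReal_smul hG hG_lt_top, hsq, h2]
  have : IsFiniteMeasure (volume.withDensity fun v => ENNReal.ofReal (g v)) := hν ▸ inferInstance
  have hg_int : Integrable g := KacChaos.integrable_of_isFiniteMeasure_withDensity hg_meas hg_nonneg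
  obtain ⟨d, hd, hdp⟩ := KacChaos.exists_ofReal_one_add_two_div_le hp
  have hgd := KacChaos.lintegral_ofReal_rpow_lt_top hg_meas hg_int hgp
    (le_add_of_nonneg_right (by positivity)) hdp
  exact ⟨hμ_symm, fun k hk => KacChaos.tendsto_marginal_tensorPower hg_meas hν hsq_int hsq_mean
    hd hgd.ne hμ_symm hμ_entropy (Nat.one_le_iff_ne_zero.1 hk)⟩

theorem mainTheorem7
    (g : ℝ → ℝ) (hg_meas : Measurable g) (hg_nonneg : ∀ v, 0 ≤ g v)
    (ν : ProbabilityMeasure ℝ)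
    (hν : (ν : Measure ℝ) = volume.withDensity (fun v => ENNReal.ofReal (g v)))
    (h2 : ∫ v, g v * v ^ 2 = 1)
    (h4 : Integrable (fun v => g v * v ^ 4))
    (p : ENNReal) (hp : 1 < p) (hgp : MemLp g p)
    (μ : ∀ N : ℕ, ProbabilityMeasure (KacChaos.KacSphere N))
    (hμ_symm : ∀ N, 1 ≤ N → KacChaos.IsSymmetric (μ N : Measure (KacChaos.KacSphere N)))
    (hμ_entropy : Tendsto
      (fun N : ℕ => InformationTheory.klDiv
        (μ N : Measure (KacChaos.KacSphere N)) (KacChaos.condTensor g N) / (N : ENNReal))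
      atTop (𝓝 0)) :
    KacChaos.IsChaotic ν μ ∧
      ∀ k : ℕ, 1 ≤ k →
        Tendsto (fun N => KacChaos.marginal k (μ N)) atTop (𝓝 (KacChaos.tensorPower ν k)) := by
  have hchaos := mainTheorem7_general g hg_meas hg_nonneg ν hν h2 p hp hgp μ hμ_symm hμ_entropy
  exact ⟨hchaos, hchaos.tendsto_marginal⟩
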